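/- Let $G$ be a local Lie group with Lie algebra $\mathfrak g$ (real, finite-dimensional), written in normal coordinates, i.e. identified near $e$ with a neighbourhood of $0$ in $\mathfrak g$ by $\exp$. Let $H=\exp\mathfrak h$ be a local closed subgroup with Lie algebra $\mathfrak h$, let $\mathfrak g=V\oplus\mathfrak h$ as vector spaces, and let $\Pi:\mathfrak g\to V$ be the projection parallel to $\mathfrak h$. Let $Q=\{\exp(\xi+\varphi(\xi)):\xi\in V \text{ near } 0\}$ be a smooth section of the left cosets of $H$ with $T_eQ=V$, where $\varphi:V\to\mathfrak h$ is smooth near $0$, $\varphi(0)=0$, $d\varphi(0)=0$, and let $R:V\times V\to\mathfrak h$ be the symmetric bilinear map with $\varphi(\xi)=R(\xi,\xi)+o(\|\xi\|^2)$. On $Q$, with coordinate $\xi\in V$, consider the local loop $x\times y=\Pi_Q(x\cdot y)$, where $\Pi_Q:G\to Q$ is the projection parallel to $H$, so that $g\in\Pi_Q(g)H$. Write $\mu(x,y)$ for the loop product in coordinates. The associated 3-web, near $(e,e)$ in $Q\times Q$, has the leaves $x=\mathrm{const}$, $y=\mathrm{const}$, $x\times y=\mathrm{const}$. Put $P=\partial\mu/\partial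 x$, $\widehat Q=\partial\mu/\partial y$, $\omega_1=P\,dx$, $\omega_2=\widehat Q\,dy$, and $$\Gamma^k_{ij}=-(P^{-1})^\alpha_i(\widehat Q^{-1})^\beta_j\frac{\partial^2\mu^k}{\partial x^\alpha\partial y^\beta},\qquad \omega^k_j=\Gamma^k_{ij}\omega_1^i+\Gamma^k_{jl}\omega_2^l$$ (the Chern connection; the covariant derivative of a vector is $d\xi^k+\omega^k_j\xi^j$). The tensor $b$ is defined by $d\omega^k_j-\omega^i_j\wedge\omega^k_i=b^k_{jlm}\,\omega_1^l\wedge\omega_2^m$, and $d^i_{jklm}=\overset{2}{\nabla}_m b^i_{jkl}$ is its covariant derivative along $\omega_1=0$, i.e. the coefficient of $\omega_2^m$. Round brackets denote symmetrization. The web is called hexagonal if $b^i_{(jkl)}=0$ at all points near $(e,e)$. Let $\underset{\xi\eta\zeta}{\sigma}$ denote the cyclic sum over $\xi,\eta,\zeta$. Then: 1. $b^i_{(jkl)}=0$ at $(e,e)$ if and only if, for all $\xi,\eta,\zeta\in V$, $$\underset{\xi\eta\zeta}{\sigma}\,\Pi[R(\xi,\eta),\zeta]=0.$$ 2. If the web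 is hexagonal, then $b^i_{(jkl)}=0$ and $d^i_{(jkl)m}=0$ at $(e,e)$. 3. If $b^i_{(jkl)}=0$ and $d^i_{(jkl)m}=0$ at $(e,e)$ (in particular, if the web is hexagonal), then for all $\xi,\eta,\zeta,\tau\in V$ $$\underset{\xi\eta\zeta}{\sigma}\,\Pi\Big\{[\tau,[R(\xi,\eta),\zeta]]-\big[\Pi[\tau,R(\xi,\eta)],\zeta\big]\Big\}=0.$$ -/

import Mathlib

open Filter Topology
open scoped ContDiff

noncomputable section

/-! ### The three-web of a local loop and its Chern connection

A local loop is given in coordinates by a product `μ : F → F → F` near `(0, 0)`.  Its three-web lives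
on a neighbourhood of `(0, 0)` in `F × F` and has the leaves `x = const`, `y = const` and
`μ x y = const`. -/

namespace ThreeWeb

variable {F : Type*} [NormedAddCommGroup F] [NormedSpace ℝ F]

/-- The Jacobian `P = ∂μ/∂x`; the first web form is `ω₁ = P dx`. -/
def P (μ : F → F → F) (p : F × F) : F →L[ℝ] F :=
  fderiv ℝ (fun x => μ x p.2) p.1

/-- The Jacobian `Q = ∂μ/∂y`; the second web form is `ω₂ = Q dy`. -/
def Q (μ : F → F → F) (p : F × F) : F →L[ℝ] F :=
  fderiv ℝ (fun y => μ p.1 y) p.2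

/-- The mixed second derivative `∂²μ/∂x∂y`, with arguments in the order `x`, `y`. -/
def mixedDeriv (μ : F → F → F) (p : F × F) : F →L[ℝ] F →L[ℝ] F :=
  fderiv ℝ (fun x => fderiv ℝ (fun y => μ x y) p.2) p.1

/-- `Γ^k_{ij} = - P⁻¹^α_i Q⁻¹^β_j ∂²μ^k/∂x^α∂y^β`, contracted with `ξ^i η^j`. -/
def Gam (μ : F → F → F) (p : F × F) (ξ η : F) : F :=
  -mixedDeriv μ p ((P μ p).inverse ξ) ((Q μ p).inverse η)

/-- The connection form `ω^k_j = Γ^k_{ij} ω₁^i + Γ^k_{jl} ω₂^l` of the Chern connection, evaluated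
on the tangent vector `X` at `p` and contracted with `ξ^j`. -/
def conn (μ : F → F → F) (p X : F × F) (ξ : F) : F :=
  Gam μ p (P μ p X.1) ξ + Gam μ p ξ (Q μ p X.2)

/-- The tangent vector at `p` with `ω₁ = η`, `ω₂ = 0`. -/
def frame₁ (μ : F → F → F) (p : F × F) (η : F) : F × F := ((P μ p).inverse η, 0)

/-- The tangent vector at `p` with `ω₁ = 0`, `ω₂ = ζ`. -/
def frame₂ (μ : F → F → F) (p : F × F) (ζ : F) : F × F := (0, (Q μ p).inverse ζ)

/-- The curvature tensor `b^k_{jlm}` of the web at `p`, contracted with `ξ^j η^l ζ^m`.  It is defined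
by `dω^k_j - ω^i_j ∧ ω^k_i = b^k_{jlm} ω₁^l ∧ ω₂^m`, evaluated on the vectors `frame₁ η`, `frame₂ ζ`
(extended to constant, hence commuting, vector fields). -/
def b (μ : F → F → F) (p : F × F) (ξ η ζ : F) : F :=
  fderiv ℝ (fun q => conn μ q (frame₂ μ p ζ) ξ) p (frame₁ μ p η)
    - fderiv ℝ (fun q => conn μ q (frame₁ μ p η) ξ) p (frame₂ μ p ζ)
    - (conn μ p (frame₂ μ p ζ) (conn μ p (frame₁ μ p η) ξ)
      - conn μ p (frame₁ μ p η) (conn μ p (frame₂ μ p ζ) ξ))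

/-- The tensor `d^i_{jklm} = ∇²_m b^i_{jkl}` at `p`, contracted with `ξ^j η^k ζ^l τ^m`: the covariant
derivative of `b` for the Chern connection, in the direction of `frame₂ τ`. -/
def d (μ : F → F → F) (p : F × F) (ξ η ζ τ : F) : F :=
  fderiv ℝ (fun q => b μ q ξ η ζ) p (frame₂ μ p τ)
    + conn μ p (frame₂ μ p τ) (b μ p ξ η ζ)
    - b μ p (conn μ p (frame₂ μ p τ) ξ) η ζ
    - b μ p ξ (conn μ p (frame₂ μ p τ) η) ζ
    - b μ p ξ η (conn μ p (frame₂ μ p τ) ζ)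

/-- Symmetrization of a function of three arguments (round brackets around three indices). -/
def sym₃ (f : F → F → F → F) (ξ η ζ : F) : F :=
  (1 / 6 : ℝ) • (f ξ η ζ + f η ζ ξ + f ζ ξ η + f η ξ ζ + f ξ ζ η + f ζ η ξ)

/-- The condition `b^i_{(jkl)} = 0` at the point `p` of the web. -/
def SymBVanishesAt (μ : F → F → F) (p : F × F) : Prop :=
  ∀ ξ η ζ : F, sym₃ (b μ p) ξ η ζ = 0

/-- The condition `d^i_{(jkl)m} = 0` at the point `p` of the web. -/
def SymDVanishesAt (μ : F → F → F) (p : F × F) : Prop :=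
  ∀ ξ η ζ τ : F, sym₃ (fun ξ η ζ => d μ p ξ η ζ τ) ξ η ζ = 0

/-- The web of the local loop `μ` is hexagonal: `b^i_{(jkl)} = 0` at every point of the web. -/
def IsHexagonal (μ : F → F → F) : Prop :=
  ∀ᶠ p in 𝓝 ((0, 0) : F × F), SymBVanishesAt μ p

end ThreeWeb

/-! ### Local Lie groups and loops embedded as sections of `G / H` -/

/-- A local Lie group in normal coordinates: a neighbourhood of `0` in the vector space `E` underlying
the Lie algebra, the exponential map being the identity.  The inverse of `x` is `-x`. -/
structure LocalLieGroup (E : Type*) [NormedAddCommGroup E] [NormedSpace ℝ E] where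
  mul : E → E → E
  contDiffAt_mul : ContDiffAt ℝ ∞ (fun p : E × E => mul p.1 p.2) (0, 0)
  mul_zero : ∀ᶠ x in 𝓝 (0 : E), mul x 0 = x
  zero_mul : ∀ᶠ x in 𝓝 (0 : E), mul 0 x = x
  mul_assoc : ∀ᶠ p in 𝓝 ((0, 0, 0) : E × E × E),
    mul (mul p.1 p.2.1) p.2.2 = mul p.1 (mul p.2.1 p.2.2)
  /-- The coordinates are normal: `t ↦ t • x` are the one-parameter subgroups. -/
  mul_smul_smul : ∀ᶠ x in 𝓝 (0 : E), ∀ s ∈ Set.Icc (-1 : ℝ) 1, ∀ t ∈ Set.Icc (-1 : ℝ) 1,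
    mul (s • x) (t • x) = (s + t) • x

/-- The Lie bracket of a local Lie group: the antisymmetrized mixed second derivative of the
multiplication at the identity. -/
def LocalLieGroup.bracket {E : Type*} [NormedAddCommGroup E] [NormedSpace ℝ E]
    (G : LocalLieGroup E) (X Y : E) : E :=
  ThreeWeb.mixedDeriv G.mul (0, 0) X Y - ThreeWeb.mixedDeriv G.mul (0, 0) Y X

/-- A local loop embedded in a local Lie group `G` as a section `Q` of the left cosets of `H`, where
`H = exp 𝔥` is a local subgroup and `Q = {exp (ξ + φ ξ) | ξ ∈ V}` is a submanifold with tangent space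
`V` at the identity, `V` being a complement of `𝔥`. -/
structure EmbeddedLoop (E : Type*) [NormedAddCommGroup E] [NormedSpace ℝ E] where
  G : LocalLieGroup E
  V : Submodule ℝ E
  𝔥 : Submodule ℝ E
  isCompl : IsCompl V 𝔥
  mul_mem : ∀ᶠ p in 𝓝 ((0, 0) : 𝔥 × 𝔥), G.mul (p.1 : E) (p.2 : E) ∈ 𝔥
  φ : V → 𝔥
  contDiffAt_φ : ContDiffAt ℝ ∞ φ 0
  φ_zero : φ 0 = 0
  fderiv_φ_zero : fderiv ℝ φ 0 = 0

namespace EmbeddedLoop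

variable {E : Type*} [NormedAddCommGroup E] [NormedSpace ℝ E] (L : EmbeddedLoop E)

/-- The linear projection `Π : 𝔤 → V` parallel to `𝔥`. -/
def proj : E →ₗ[ℝ] L.V := Submodule.projectionOnto L.V L.𝔥 L.isCompl

/-- The symmetric bilinear map `R` with `φ ξ = R (ξ, ξ) + o(‖ξ‖²)`: half of the second derivative of
`φ` at `0`. -/
def R (ξ η : L.V) : L.𝔥 := (1 / 2 : ℝ) • fderiv ℝ (fderiv ℝ L.φ) 0 ξ η

/-- The point of `Q` with coordinate `ξ`. -/
def sec (ξ : L.V) : E := (ξ : E) + (L.φ ξ : E)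

/-- The map `Q × H → G`, `(q, h) ↦ q h`, in the coordinates of `Q` and `H`. -/
def secMul (p : L.V × L.𝔥) : E := L.G.mul (L.sec p.1) (p.2 : E)

theorem sec_zero : L.sec 0 = 0 := by simp [sec, L.φ_zero]

theorem contDiffAt_sec : ContDiffAt ℝ ∞ L.sec 0 :=
  L.V.subtypeL.contDiff.contDiffAt.add
    (L.𝔥.subtypeL.contDiff.contDiffAt.comp (0 : L.V) L.contDiffAt_φ)

theorem contDiffAt_secMul : ContDiffAt ℝ ∞ L.secMul 0 := by
  have h1 : ContDiffAt ℝ ∞ (fun p : L.V × L.𝔥 => L.sec p.1) 0 :=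
    ContDiffAt.comp (0 : L.V × L.𝔥) (g := L.sec) (f := Prod.fst) L.contDiffAt_sec contDiffAt_fst
  have h2 : ContDiffAt ℝ ∞ (fun p : L.V × L.𝔥 => (p.2 : E)) 0 :=
    ContDiffAt.comp (0 : L.V × L.𝔥) (g := fun h : L.𝔥 => (h : E)) (f := Prod.snd)
      L.𝔥.subtypeL.contDiff.contDiffAt contDiffAt_snd
  have h3 := L.G.contDiffAt_mul
  refine ContDiffAt.comp (0 : L.V × L.𝔥) (g := fun p : E × E => L.G.mul p.1 p.2)
    (f := fun p : L.V × L.𝔥 => (L.sec p.1, (p.2 : E))) ?_ (h1.prodMk h2)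
  simpa [L.sec_zero] using h3

theorem hasFDerivAt_sec : HasFDerivAt L.sec L.V.subtypeL 0 := by
  have h1 : HasFDerivAt L.φ (0 : L.V →L[ℝ] L.𝔥) 0 := by
    rw [← L.fderiv_φ_zero]
    exact (L.contDiffAt_φ.differentiableAt (by simp)).hasFDerivAt
  have h2 := (L.V.subtypeL.hasFDerivAt (x := (0 : L.V))).add
    ((L.𝔥.subtypeL.hasFDerivAt (x := L.φ 0)).comp (0 : L.V) h1)
  rw [ContinuousLinearMap.comp_zero, add_zero] at h2
  exact h2

theorem hasFDerivAt_mul (G : LocalLieGroup E) :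
    HasFDerivAt (fun p : E × E => G.mul p.1 p.2)
      (ContinuousLinearMap.fst ℝ E E + ContinuousLinearMap.snd ℝ E E) (0, 0) := by
  have h := (G.contDiffAt_mul.differentiableAt (by simp)).hasFDerivAt
  set D := fderiv ℝ (fun p : E × E => G.mul p.1 p.2) (0, 0)
  have hl : D.comp (ContinuousLinearMap.inl ℝ E E) = ContinuousLinearMap.id ℝ E := by
    have h1 : HasFDerivAt (fun x : E => G.mul x 0) (D.comp (ContinuousLinearMap.inl ℝ E E)) 0 :=
      HasFDerivAt.comp (0 : E) (g := fun p : E × E => G.mul p.1 p.2) (f := fun x : E => (x, (0 : E)))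
        h (ContinuousLinearMap.inl ℝ E E).hasFDerivAt
    exact h1.unique ((hasFDerivAt_id (0 : E)).congr_of_eventuallyEq G.mul_zero)
  have hr : D.comp (ContinuousLinearMap.inr ℝ E E) = ContinuousLinearMap.id ℝ E := by
    have h1 : HasFDerivAt (fun x : E => G.mul 0 x) (D.comp (ContinuousLinearMap.inr ℝ E E)) 0 :=
      HasFDerivAt.comp (0 : E) (g := fun p : E × E => G.mul p.1 p.2) (f := fun x : E => ((0 : E), x))
        h (ContinuousLinearMap.inr ℝ E E).hasFDerivAt
    exact h1.unique ((hasFDerivAt_id (0 : E)).congr_of_eventuallyEq G.zero_mul)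
  have hD : D = ContinuousLinearMap.fst ℝ E E + ContinuousLinearMap.snd ℝ E E := by
    ext x
    · simpa using congrArg (fun f => f x) hl
    · simpa using congrArg (fun f => f x) hr
  rwa [hD] at h

variable [FiniteDimensional ℝ E]

/-- The identification `V × 𝔥 ≃ E`, `(ξ, h) ↦ ξ + h`. -/
def decomp : (L.V × L.𝔥) ≃L[ℝ] E :=
  (Submodule.prodEquivOfIsCompl L.V L.𝔥 L.isCompl).toContinuousLinearEquiv

theorem hasFDerivAt_secMul :
    HasFDerivAt L.secMul (L.decomp : (L.V × L.𝔥) →L[ℝ] E) 0 := by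
  have h1 : HasFDerivAt (fun p : L.V × L.𝔥 => (L.sec p.1, (p.2 : E)))
      ((L.V.subtypeL.comp (ContinuousLinearMap.fst ℝ L.V L.𝔥)).prod
        (L.𝔥.subtypeL.comp (ContinuousLinearMap.snd ℝ L.V L.𝔥))) 0 :=
    (HasFDerivAt.comp (0 : L.V × L.𝔥) (g := L.sec) (f := Prod.fst)
      L.hasFDerivAt_sec hasFDerivAt_fst).prodMk
      (L.𝔥.subtypeL.comp (ContinuousLinearMap.snd ℝ L.V L.𝔥)).hasFDerivAt
  have h2 : HasFDerivAt (fun p : E × E => L.G.mul p.1 p.2)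
      (ContinuousLinearMap.fst ℝ E E + ContinuousLinearMap.snd ℝ E E)
      ((fun p : L.V × L.𝔥 => (L.sec p.1, (p.2 : E))) 0) := by
    simpa [L.sec_zero] using hasFDerivAt_mul L.G
  have h3 := HasFDerivAt.comp (0 : L.V × L.𝔥) h2 h1
  have h4 : (ContinuousLinearMap.fst ℝ E E + ContinuousLinearMap.snd ℝ E E).comp
      ((L.V.subtypeL.comp (ContinuousLinearMap.fst ℝ L.V L.𝔥)).prod
        (L.𝔥.subtypeL.comp (ContinuousLinearMap.snd ℝ L.V L.𝔥)))
      = (L.decomp : (L.V × L.𝔥) →L[ℝ] E) := by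
    refine ContinuousLinearMap.ext fun x => ?_
    change (x.1 : E) + (x.2 : E) = Submodule.prodEquivOfIsCompl L.V L.𝔥 L.isCompl x
    exact (Submodule.coe_prodEquivOfIsCompl' _ _ L.isCompl x).symm
  rw [h4] at h3
  exact h3

/-- The projection `Π_Q : G → Q` parallel to `H`, in the coordinates of `Q`: near the identity every
`g` is uniquely of the form `q h` with `q ∈ Q`, `h ∈ H`, and `projQ g` is the coordinate of `q`. -/
def projQ (g : E) : L.V :=
  haveI : CompleteSpace (L.V × L.𝔥) := FiniteDimensional.complete ℝ (L.V × L.𝔥)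
  (L.contDiffAt_secMul.localInverse L.hasFDerivAt_secMul (by simp) g).1

/-- The loop product `x × y = Π_Q (x · y)` on `Q`, in the coordinates of `Q`. -/
def loopMul (x y : L.V) : L.V := L.projQ (L.G.mul (L.sec x) (L.sec y))

end EmbeddedLoop

end

/-! The loop product is `a (s x) y`, where `a` is the action of `G` on `G / H` in the coordinate of
`Q` and `s` is the section. Write ρ_z for the infinitesimal action at `z` (`infAct`), ι = ds(0), S =
d²s(0). On the leaf `x = 0` one has Q = id and P = ρ_z ∘ ι, and the higher derivatives needed there
are expressed by ρ, Dρ, D²ρ, ι and S. Most terms of the curvature then cancel, and `b_comp_section`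
gives, with v = P⁻¹ξ, b(ξ,ξ,ξ) = -ρ_z [K, ιv], where K = S(v,v) - ι P⁻¹ ρ_z S(v,v) is the component
of S(v,v) in the stabilizer algebra ker ρ_z along the image of ι.

At `z = 0`, ρ₀ = Π and S = 2R takes values in 𝔥 = ker Π, so K = 2R(v,v); polarization yields the
first claim.

Where the symmetrized b vanishes, the symmetrized d is the plain derivative of the symmetrized b
(`SymBVanishesAt.sym₃_d`), which gives the second claim at once. For the third, the formula for b is
differentiated along the leaf `x = 0`. Since ρ is a homomorphism (`fderiv_infAct_sub`), Dρ₀(τ)X =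
Π[X, τ] for X in ker ρ₀; this turns derivatives of ρ into brackets, and the terms containing dv
cancel by the first condition. -/

/-! ### Differentiation of inverse operators. -/

section Inverse

variable {X F : Type*} [NormedAddCommGroup X] [NormedSpace ℝ X] [NormedAddCommGroup F]
  [NormedSpace ℝ F] [CompleteSpace F]

theorem ContinuousLinearMap.IsInvertible.eventually {T : F →L[ℝ] F} (h : T.IsInvertible) :
    ∀ᶠ S in 𝓝 T, S.IsInvertible := by
  obtain ⟨e, rfl⟩ := h
  filter_upwards [ContinuousLinearEquiv.nhds e] with S hS
  exact hS

theorem DifferentiableAt.clm_inverse {T : X → F →L[ℝ] F} {p : X} (hT : DifferentiableAt ℝ T p)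
    (hp : (T p).IsInvertible) : DifferentiableAt ℝ (fun q => (T q).inverse) p :=
  DifferentiableAt.comp p
    ((hp.contDiffAt_map_inverse (n := 1)).differentiableAt (by simp)) hT

/-- Differentiate T T⁻¹ξ = ξ and solve for the derivative of T⁻¹ξ. -/
theorem HasFDerivAt.clm_inverse_apply {T : X → F →L[ℝ] F} {T' : X →L[ℝ] F →L[ℝ] F} {p : X}
    (hT : HasFDerivAt T T' p) (hp : (T p).IsInvertible) (ξ : F) :
    HasFDerivAt (fun q => (T q).inverse ξ)
      (-((T p).inverse ∘L (T'.flip ((T p).inverse ξ)))) p := by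
  have hd : DifferentiableAt ℝ (fun q => (T q).inverse ξ) p :=
    (hT.differentiableAt.clm_inverse hp).clm_apply (differentiableAt_const ξ)
  have h1 := hT.clm_apply hd.hasFDerivAt
  have h2 : HasFDerivAt (fun q => T q ((T q).inverse ξ)) (0 : X →L[ℝ] F) p := by
    refine (hasFDerivAt_const ξ p).congr_of_eventuallyEq ?_
    filter_upwards [hT.continuousAt.eventually hp.eventually] with q hq
    exact hq.self_apply_inverse ξ
  have h3 := h1.unique h2
  convert hd.hasFDerivAt using 1
  ext w
  have h4 := congrArg (fun f => (T p).inverse (f w)) h3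
  simp only [add_apply, ContinuousLinearMap.comp_apply, map_add,
    hp.inverse_apply_self, zero_apply, map_zero] at h4
  simp only [neg_apply, ContinuousLinearMap.comp_apply]
  rw [neg_eq_iff_add_eq_zero, add_comm]
  exact h4

end Inverse

/-! ### The web tensors through joint derivatives of the product. -/

namespace ThreeWeb

variable {F : Type*} [NormedAddCommGroup F] [NormedSpace ℝ F]

/-- The first derivative of `μ` in both variables jointly. -/
noncomputable def jet₁ (μ : F → F → F) : F × F → F × F →L[ℝ] F :=
  fderiv ℝ (fun p : F × F => μ p.1 p.2)

/-- The second derivative of `μ` in both variables jointly. -/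
noncomputable def jet₂ (μ : F → F → F) : F × F → F × F →L[ℝ] F × F →L[ℝ] F :=
  fderiv ℝ (jet₁ μ)

/-- The third derivative of `μ` in both variables jointly. -/
noncomputable def jet₃ (μ : F → F → F) : F × F → F × F →L[ℝ] F × F →L[ℝ] F × F →L[ℝ] F :=
  fderiv ℝ (jet₂ μ)

/-- `μ` is smooth enough at `p`, and both translations are local diffeomorphisms there. -/
structure RegularAt (μ : F → F → F) (p : F × F) : Prop where
  contDiffAt : ContDiffAt ℝ 4 (fun p : F × F => μ p.1 p.2) p
  isInvertible_P : (P μ p).IsInvertible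
  isInvertible_Q : (Q μ p).IsInvertible

variable {μ : F → F → F} {p : F × F}

section Jets

variable (h : ContDiffAt ℝ 4 (fun p : F × F => μ p.1 p.2) p)
include h

theorem contDiffAt_jet₁ : ContDiffAt ℝ 3 (jet₁ μ) p := h.fderiv_right (by norm_num)

theorem contDiffAt_jet₂ : ContDiffAt ℝ 2 (jet₂ μ) p :=
  (contDiffAt_jet₁ h).fderiv_right (by norm_num)

set_option maxSynthPendingDepth 6 in
theorem contDiffAt_jet₃ : ContDiffAt ℝ 1 (jet₃ μ) p :=
  (contDiffAt_jet₂ h).fderiv_right (by norm_num)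

theorem hasFDerivAt_jet₀ : HasFDerivAt (fun p : F × F => μ p.1 p.2) (jet₁ μ p) p :=
  (h.differentiableAt (by simp)).hasFDerivAt

theorem hasFDerivAt_jet₁ : HasFDerivAt (jet₁ μ) (jet₂ μ p) p :=
  ((contDiffAt_jet₁ h).differentiableAt (by simp)).hasFDerivAt

theorem hasFDerivAt_jet₂ : HasFDerivAt (jet₂ μ) (jet₃ μ p) p :=
  ((contDiffAt_jet₂ h).differentiableAt (by simp)).hasFDerivAt

theorem jet₂_symm (v w : F × F) : jet₂ μ p v w = jet₂ μ p w v :=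
  (h.isSymmSndFDerivAt (by simp; norm_num)).eq v w

theorem jet₃_symm_left (v w : F × F) : jet₃ μ p v w = jet₃ μ p w v :=
  ((contDiffAt_jet₁ h).isSymmSndFDerivAt (by simp; norm_num)).eq v w

/-- The symmetry of the second derivative holds near `p`, hence can be differentiated. -/
theorem jet₃_symm_right (u v w : F × F) : jet₃ μ p u v w = jet₃ μ p u w v := by
  have h1 := ((hasFDerivAt_jet₂ h).clm_apply (hasFDerivAt_const v p)).clm_apply
    (hasFDerivAt_const w p)
  have h2 := ((hasFDerivAt_jet₂ h).clm_apply (hasFDerivAt_const w p)).clm_apply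
    (hasFDerivAt_const v p)
  have h3 : (fun q => jet₂ μ q v w) =ᶠ[𝓝 p] fun q => jet₂ μ q w v := by
    filter_upwards [h.eventually (by simp)] with q hq
    exact jet₂_symm hq v w
  have h4 := congrArg (fun f => f u) (h1.unique (h2.congr_of_eventuallyEq h3))
  simpa using h4

theorem P_eq : P μ p = jet₁ μ p ∘L ContinuousLinearMap.inl ℝ F F :=
  (HasFDerivAt.comp p.1 (g := fun p : F × F => μ p.1 p.2) (f := fun x => (x, p.2))
    (hasFDerivAt_jet₀ h) (hasFDerivAt_prodMk_left p.1 p.2)).fderiv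

theorem Q_eq : Q μ p = jet₁ μ p ∘L ContinuousLinearMap.inr ℝ F F :=
  (HasFDerivAt.comp p.2 (g := fun p : F × F => μ p.1 p.2) (f := fun y => (p.1, y))
    (hasFDerivAt_jet₀ h) (hasFDerivAt_prodMk_right p.1 p.2)).fderiv

theorem mixedDeriv_apply (v w : F) : mixedDeriv μ p v w = jet₂ μ p (v, 0) (0, w) := by
  have h1 : HasFDerivAt (fun x => jet₁ μ (x, p.2) ∘L ContinuousLinearMap.inr ℝ F F) _ p.1 :=
    (HasFDerivAt.comp p.1 (g := jet₁ μ) (f := fun x => (x, p.2))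
      (hasFDerivAt_jet₁ h) (hasFDerivAt_prodMk_left p.1 p.2)).clm_comp
      (hasFDerivAt_const (ContinuousLinearMap.inr ℝ F F) p.1)
  have h2 : (fun x => fderiv ℝ (fun y => μ x y) p.2) =ᶠ[𝓝 p.1]
      fun x => jet₁ μ (x, p.2) ∘L ContinuousLinearMap.inr ℝ F F := by
    have hc : Tendsto (fun x : F => (x, p.2)) (𝓝 p.1) (𝓝 p) :=
      (Continuous.prodMk_left p.2).tendsto p.1
    filter_upwards [hc.eventually (h.eventually (by simp))] with x hx
    exact Q_eq hx
  rw [mixedDeriv, (h1.congr_of_eventuallyEq h2).fderiv]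
  simp

theorem hasFDerivAt_P : HasFDerivAt (P μ)
    (((ContinuousLinearMap.inl ℝ F F).precomp F).comp (jet₂ μ p)) p := by
  refine HasFDerivAt.congr_of_eventuallyEq (f := fun q =>
    (ContinuousLinearMap.inl ℝ F F).precomp F (jet₁ μ q)) ?_ ?_
  · exact (ContinuousLinearMap.hasFDerivAt _).comp p (hasFDerivAt_jet₁ h)
  · filter_upwards [h.eventually (by simp)] with q hq
    exact P_eq hq

theorem hasFDerivAt_Q : HasFDerivAt (Q μ)
    (((ContinuousLinearMap.inr ℝ F F).precomp F).comp (jet₂ μ p)) p := by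
  refine HasFDerivAt.congr_of_eventuallyEq (f := fun q =>
    (ContinuousLinearMap.inr ℝ F F).precomp F (jet₁ μ q)) ?_ ?_
  · exact (ContinuousLinearMap.hasFDerivAt _).comp p (hasFDerivAt_jet₁ h)
  · filter_upwards [h.eventually (by simp)] with q hq
    exact Q_eq hq

end Jets

theorem RegularAt.eventually [CompleteSpace F] (h : RegularAt μ p) : ∀ᶠ q in 𝓝 p, RegularAt μ q := by
  filter_upwards [h.contDiffAt.eventually (by simp),
    (hasFDerivAt_P h.contDiffAt).continuousAt.eventually h.isInvertible_P.eventually,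
    (hasFDerivAt_Q h.contDiffAt).continuousAt.eventually h.isInvertible_Q.eventually]
    with q h1 h2 h3
  exact ⟨h1, h2, h3⟩

theorem RegularAt.conn_frame₁ (h : RegularAt μ p) (x ξ : F) :
    conn μ p (x, 0) ξ = -jet₂ μ p (x, 0) (0, (Q μ p).inverse ξ) := by
  have h0 : ((0, 0) : F × F) = 0 := rfl
  simp [conn, Gam, mixedDeriv_apply h.contDiffAt, h.isInvertible_P.inverse_apply_self, h0]

theorem RegularAt.conn_frame₂ (h : RegularAt μ p) (z ξ : F) :
    conn μ p (0, z) ξ = -jet₂ μ p ((P μ p).inverse ξ, 0) (0, z) := by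
  simp [conn, Gam, mixedDeriv_apply h.contDiffAt, h.isInvertible_Q.inverse_apply_self]

/-- The curvature tensor in terms of the derivatives of the product. -/
theorem RegularAt.b_eq [CompleteSpace F] (h : RegularAt μ p) (ξ η ζ : F) :
    b μ p ξ η ζ =
      -(jet₃ μ p ((P μ p).inverse η, 0) ((P μ p).inverse ξ, 0) (0, (Q μ p).inverse ζ)
        - jet₂ μ p ((P μ p).inverse
            (jet₂ μ p ((P μ p).inverse η, 0) ((P μ p).inverse ξ, 0)), 0) (0, (Q μ p).inverse ζ))
      + (jet₃ μ p (0, (Q μ p).inverse ζ) ((P μ p).inverse η, 0) (0, (Q μ p).inverse ξ)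
        - jet₂ μ p ((P μ p).inverse η, 0) (0, (Q μ p).inverse
            (jet₂ μ p (0, (Q μ p).inverse ζ) (0, (Q μ p).inverse ξ))))
      - jet₂ μ p ((P μ p).inverse
          (jet₂ μ p ((P μ p).inverse η, 0) (0, (Q μ p).inverse ξ)), 0) (0, (Q μ p).inverse ζ)
      + jet₂ μ p ((P μ p).inverse η, 0) (0, (Q μ p).inverse
          (jet₂ μ p ((P μ p).inverse ξ, 0) (0, (Q μ p).inverse ζ))) := by
  have hev := h.eventually
  have e1 : (fun q => conn μ q (frame₂ μ p ζ) ξ) =ᶠ[𝓝 p] fun q =>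
      -jet₂ μ q (ContinuousLinearMap.inl ℝ F F ((P μ q).inverse ξ)) (0, (Q μ p).inverse ζ) := by
    filter_upwards [hev] with q hq
    exact hq.conn_frame₂ _ _
  have e2 : (fun q => conn μ q (frame₁ μ p η) ξ) =ᶠ[𝓝 p] fun q =>
      -jet₂ μ q ((P μ p).inverse η, 0) (ContinuousLinearMap.inr ℝ F F ((Q μ q).inverse ξ)) := by
    filter_upwards [hev] with q hq
    exact hq.conn_frame₁ _ _
  -- The frame vectors are frozen at `p`; apart from the second derivative of μ, only the inverse
  -- Jacobian applied to ξ varies.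
  have dP := (hasFDerivAt_P h.contDiffAt).clm_inverse_apply h.isInvertible_P ξ
  have dQ := (hasFDerivAt_Q h.contDiffAt).clm_inverse_apply h.isInvertible_Q ξ
  have d1 := (((hasFDerivAt_jet₂ h.contDiffAt).clm_apply
    ((ContinuousLinearMap.inl ℝ F F).hasFDerivAt.comp p dP)).clm_apply
    (hasFDerivAt_const ((0, (Q μ p).inverse ζ) : F × F) p)).neg
  have d2 := (((hasFDerivAt_jet₂ h.contDiffAt).clm_apply
    (hasFDerivAt_const (((P μ p).inverse η, 0) : F × F) p)).clm_apply
    ((ContinuousLinearMap.inr ℝ F F).hasFDerivAt.comp p dQ)).neg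
  rw [b, (d1.congr_of_eventuallyEq e1).fderiv, (d2.congr_of_eventuallyEq e2).fderiv]
  simp only [frame₁, frame₂, h.conn_frame₁, h.conn_frame₂]
  simp
  have n1 (a : F) : ((-a, 0) : F × F) = -(a, 0) := by simp
  have n2 (a : F) : ((0, -a) : F × F) = -(0, a) := by simp
  simp only [n1, n2, map_neg, neg_apply, neg_neg]
  abel

end ThreeWeb

/-! ### Polarization, and symmetrization of the web tensors. -/

/-- Inclusion–exclusion on the cubic form a ↦ f(a,a,a) isolates the six mixed terms; additivity in
each slot is enough. -/
theorem sum_perm_eq_zero_of_diag {A B : Type*} [AddCommGroup A] [AddCommGroup B]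
    {f : A → A → A → B} (h₁ : ∀ a a' b c, f (a + a') b c = f a b c + f a' b c)
    (h₂ : ∀ a b b' c, f a (b + b') c = f a b c + f a b' c)
    (h₃ : ∀ a b c c', f a b (c + c') = f a b c + f a b c')
    (h : ∀ a, f a a a = 0) (x y z : A) :
    f x y z + f y z x + f z x y + f y x z + f x z y + f z y x = 0 := by
  have e : f x y z + f y z x + f z x y + f y x z + f x z y + f z y x =
      f (x + y + z) (x + y + z) (x + y + z) - f (x + y) (x + y) (x + y)
        - f (y + z) (y + z) (y + z) - f (x + z) (x + z) (x + z)
        + f x x x + f y y y + f z z z := by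
    simp only [h₁, h₂, h₃]
    abel
  rw [e]
  simp [h]

namespace ThreeWeb

variable {F : Type*} [NormedAddCommGroup F] [NormedSpace ℝ F] {μ : F → F → F} {p : F × F}

theorem sym₃_diag (f : F → F → F → F) (ξ : F) : sym₃ f ξ ξ ξ = f ξ ξ ξ := by
  unfold sym₃
  module

theorem inl_add {A : Type*} [AddZeroClass A] (a b : A) : ((a + b, 0) : A × A) = (a, 0) + (b, 0) := by simp

theorem inr_add {A : Type*} [AddZeroClass A] (a b : A) : ((0, a + b) : A × A) = (0, a) + (0, b) := by simp

section Regular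

variable [CompleteSpace F] (h : RegularAt μ p)
include h

theorem RegularAt.b_add₁ (ξ ξ' η ζ : F) : b μ p (ξ + ξ') η ζ = b μ p ξ η ζ + b μ p ξ' η ζ := by
  simp only [h.b_eq, inl_add, inr_add, map_add, add_apply]
  abel

theorem RegularAt.b_add₂ (ξ η η' ζ : F) : b μ p ξ (η + η') ζ = b μ p ξ η ζ + b μ p ξ η' ζ := by
  simp only [h.b_eq, inl_add, map_add, add_apply]
  abel

theorem RegularAt.b_add₃ (ξ η ζ ζ' : F) : b μ p ξ η (ζ + ζ') = b μ p ξ η ζ + b μ p ξ η ζ' := by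
  simp only [h.b_eq, inr_add, map_add, add_apply]
  abel

theorem RegularAt.symBVanishesAt_iff : SymBVanishesAt μ p ↔ ∀ ξ, b μ p ξ ξ ξ = 0 := by
  refine ⟨fun H ξ => by rw [← sym₃_diag (b μ p)]; exact H ξ ξ ξ, fun H ξ η ζ => ?_⟩
  rw [sym₃, sum_perm_eq_zero_of_diag h.b_add₁ h.b_add₂ h.b_add₃ H, smul_zero]

set_option maxSynthPendingDepth 6 in
theorem RegularAt.differentiableAt_b (ξ η ζ : F) :
    DifferentiableAt ℝ (fun q => b μ q ξ η ζ) p := by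
  have e : (fun q => b μ q ξ η ζ) =ᶠ[𝓝 p] _ := h.eventually.mono fun q hq => hq.b_eq ξ η ζ
  refine DifferentiableAt.congr_of_eventuallyEq ?_ e
  have h2 : DifferentiableAt ℝ (jet₂ μ) p := (hasFDerivAt_jet₂ h.contDiffAt).differentiableAt
  have h3 : DifferentiableAt ℝ (jet₃ μ) p :=
    (contDiffAt_jet₃ h.contDiffAt).differentiableAt (by simp)
  have hP : DifferentiableAt ℝ (fun q => (P μ q).inverse) p :=
    (hasFDerivAt_P h.contDiffAt).differentiableAt.clm_inverse h.isInvertible_P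
  have hQ : DifferentiableAt ℝ (fun q => (Q μ q).inverse) p :=
    (hasFDerivAt_Q h.contDiffAt).differentiableAt.clm_inverse h.isInvertible_Q
  fun_prop

end Regular

theorem RegularAt.conn_add (h : RegularAt μ p) (z ξ η : F) :
    conn μ p (0, z) (ξ + η) = conn μ p (0, z) ξ + conn μ p (0, z) η := by
  simp only [h.conn_frame₂, inl_add, map_add, add_apply, neg_add]

theorem RegularAt.conn_smul (h : RegularAt μ p) (z : F) (c : ℝ) (ξ : F) :
    conn μ p (0, z) (c • ξ) = c • conn μ p (0, z) ξ := by
  have e (a : F) : ((c • a, 0) : F × F) = c • (a, 0) := by simp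
  simp only [h.conn_frame₂, e, map_smul, smul_apply, smul_neg]

/-- Where the symmetrized curvature vanishes, so do the connection terms of its symmetrized covariant
derivative. -/
theorem SymBVanishesAt.sym₃_d [CompleteSpace F] (h : RegularAt μ p) (H : SymBVanishesAt μ p)
    (ξ η ζ τ : F) :
    sym₃ (fun ξ η ζ => d μ p ξ η ζ τ) ξ η ζ =
      fderiv ℝ (fun q => sym₃ (b μ q) ξ η ζ) p (frame₂ μ p τ) := by
  have hb := h.differentiableAt_b
  have e : HasFDerivAt (fun q => sym₃ (b μ q) ξ η ζ) _ p :=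
    ((((((hb ξ η ζ).hasFDerivAt.add (hb η ζ ξ).hasFDerivAt).add (hb ζ ξ η).hasFDerivAt).add
      (hb η ξ ζ).hasFDerivAt).add (hb ξ ζ η).hasFDerivAt).add
      (hb ζ η ξ).hasFDerivAt).const_smul (1 / 6 : ℝ)
  rw [e.fderiv]
  have hc : conn μ p (frame₂ μ p τ) (sym₃ (b μ p) ξ η ζ) = 0 := by
    have := h.conn_smul ((Q μ p).inverse τ) 0 0
    rw [H ξ η ζ, frame₂]
    simpa using this
  have h1 := H (conn μ p (frame₂ μ p τ) ξ) η ζ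
  have h2 := H ξ (conn μ p (frame₂ μ p τ) η) ζ
  have h3 := H ξ η (conn μ p (frame₂ μ p τ) ζ)
  simp only [sym₃, frame₂, h.conn_smul, h.conn_add] at hc h1 h2 h3
  simp only [sym₃, d, frame₂, add_apply, smul_apply]
  -- Over all permutations the connection terms regroup into the connection applied to sym b, and
  -- into sym b with one argument replaced by its image under the connection.
  linear_combination (norm := module) hc - h1 - h2 - h3

theorem IsHexagonal.symDVanishesAt [CompleteSpace F] (h : RegularAt μ (0, 0)) (H : IsHexagonal μ) :
    SymDVanishesAt μ (0, 0) := by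
  intro ξ η ζ τ
  rw [H.self_of_nhds.sym₃_d h]
  have e : (fun q => sym₃ (b μ q) ξ η ζ) =ᶠ[𝓝 (0, 0)] fun _ => 0 := H.mono fun q hq => hq ξ η ζ
  rw [e.fderiv_eq]
  simp

end ThreeWeb

theorem ContDiffAt.of_infty {X Y : Type*} [NormedAddCommGroup X] [NormedSpace ℝ X]
    [NormedAddCommGroup Y] [NormedSpace ℝ Y] {f : X → Y} {x : X} (h : ContDiffAt ℝ ∞ f x) :
    ContDiffAt ℝ 4 f x := by
  exact_mod_cast contDiffAt_infty.1 h 4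

/-! ### Local actions and their infinitesimal generators. -/

section Action

variable {E F : Type*} [NormedAddCommGroup E] [NormedSpace ℝ E] [NormedAddCommGroup F]
  [NormedSpace ℝ F]

/-- A smooth local action of the local Lie group `G` near `0 : F`. -/
structure IsLocalAction (G : LocalLieGroup E) (a : E → F → F) : Prop where
  contDiffAt : ContDiffAt ℝ 4 (fun p : E × F => a p.1 p.2) (0, 0)
  zero_act : ∀ᶠ z in 𝓝 (0 : F), a 0 z = z
  act_act : ∀ᶠ p in 𝓝 ((0, 0, 0) : E × E × F),
    a p.1 (a p.2.1 p.2.2) = a (G.mul p.1 p.2.1) p.2.2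

/-- The infinitesimal action: `infAct a z X` is the value at `z` of the vector field generated by
`X`. -/
noncomputable def infAct (a : E → F → F) (z : F) : E →L[ℝ] F :=
  fderiv ℝ (fun p : E × F => a p.1 p.2) (0, z) ∘L ContinuousLinearMap.inl ℝ E F

/-- This is where normal coordinates enter: (sX)(tX) = (s+t)X has no st-term. -/
theorem LocalLieGroup.mixedDeriv_self (G : LocalLieGroup E) (X : E) :
    ThreeWeb.mixedDeriv G.mul (0, 0) X X = 0 := by
  have hG := G.contDiffAt_mul.of_infty
  set M := ThreeWeb.mixedDeriv G.mul (0, 0) with hM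
  -- M(X,X) is quadratic in X, so vanishing near 0 gives vanishing everywhere by scaling.
  suffices h : ∀ᶠ X in 𝓝 (0 : E), M X X = 0 by
    have h1 : Tendsto (fun c : ℝ => c • X) (𝓝[≠] 0) (𝓝 0) :=
      tendsto_nhdsWithin_of_tendsto_nhds (by
        simpa using (tendsto_id (α := ℝ) (x := 𝓝 0)).smul_const X)
    obtain ⟨c, hc, hc0⟩ := ((h1.eventually h).and self_mem_nhdsWithin).exists
    simpa [show c ≠ 0 from hc0] using hc
  filter_upwards [G.mul_smul_smul] with X hX
  rw [hM, ThreeWeb.mixedDeriv_apply hG]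
  let ℓ : ℝ × ℝ →L[ℝ] E × E := (ContinuousLinearMap.toSpanSingleton ℝ X).prodMap
    (ContinuousLinearMap.toSpanSingleton ℝ X)
  have hℓ : Tendsto ℓ (𝓝 (0, 0)) (𝓝 (0, 0)) := by
    simpa [ℓ] using ℓ.continuous.tendsto (0, 0)
  have hI : ∀ᶠ s in 𝓝 (0 : ℝ), s ∈ Set.Icc (-1 : ℝ) 1 := Icc_mem_nhds (by simp) (by simp)
  have hmul : (fun q : ℝ × ℝ => G.mul (ℓ q).1 (ℓ q).2) =ᶠ[𝓝 (0, 0)]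
      (ContinuousLinearMap.toSpanSingleton ℝ X).comp
        (ContinuousLinearMap.fst ℝ ℝ ℝ + ContinuousLinearMap.snd ℝ ℝ ℝ) := by
    filter_upwards [hI.prod_nhds hI] with q hq
    exact hX q.1 hq.1 q.2 hq.2
  have hjet : (fun q : ℝ × ℝ => ThreeWeb.jet₁ G.mul (ℓ q) (ℓ (0, 1))) =ᶠ[𝓝 (0, 0)]
      fun _ => X := by
    filter_upwards [hℓ.eventually (hG.eventually (by simp)), hmul.eventuallyEq_nhds] with q hq hq'
    have h1 := (ThreeWeb.hasFDerivAt_jet₀ hq).comp q ℓ.hasFDerivAt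
    have h2 := h1.unique ((ContinuousLinearMap.hasFDerivAt _).congr_of_eventuallyEq hq')
    simpa using congrArg (fun f => f (0, 1)) h2
  have h3 : HasFDerivAt (ThreeWeb.jet₁ G.mul) (ThreeWeb.jet₂ G.mul (0, 0)) (ℓ (0, 0)) := by
    have : ℓ (0, 0) = (0, 0) := by simp [ℓ]
    rw [this]
    exact ThreeWeb.hasFDerivAt_jet₁ hG
  have h4 := (h3.comp (0, 0) ℓ.hasFDerivAt).clm_apply (hasFDerivAt_const (ℓ (0, 1)) (0, 0))
  have h5 := h4.unique ((hasFDerivAt_const X (0, 0)).congr_of_eventuallyEq hjet)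
  simpa [ℓ] using congrArg (fun f => f (1, 0)) h5

namespace IsLocalAction

variable {G : LocalLieGroup E} {a : E → F → F} (h : IsLocalAction G a)
include h

theorem eventually_contDiffAt :
    ∀ᶠ z in 𝓝 (0 : F), ContDiffAt ℝ 4 (fun p : E × F => a p.1 p.2) (0, z) :=
  ((Continuous.prodMk_right (0 : E)).tendsto (0 : F)).eventually (h.contDiffAt.eventually (by simp))

theorem eventually_contDiffAt_infAct : ∀ᶠ z in 𝓝 (0 : F), ContDiffAt ℝ 3 (infAct a) z := by
  filter_upwards [h.eventually_contDiffAt] with z hz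
  exact (ContDiffAt.comp z (g := fderiv ℝ (fun p : E × F => a p.1 p.2)) (f := fun z => ((0 : E), z))
    (hz.fderiv_right (m := 3) (by norm_num)) (contDiffAt_const.prodMk contDiffAt_id)).clm_comp
    contDiffAt_const

/-- Differentiate g·(p₁·p₂) = (g p₁)·p₂ at g = 0; the right translation by p₁ produces the factor
`P`. -/
theorem infAct_act :
    ∀ᶠ p in 𝓝 ((0, 0) : E × F), ∀ X, infAct a (a p.1 p.2) X =
      fderiv ℝ (fun p : E × F => a p.1 p.2) p (ThreeWeb.P G.mul (0, p.1) X, 0) := by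
  have hG := G.contDiffAt_mul.of_infty
  have ha0 : a 0 0 = 0 := h.zero_act.self_of_nhds
  have t1 : Tendsto (fun p : E × F => ((0, p.1, p.2) : E × E × F)) (𝓝 (0, 0)) (𝓝 (0, 0, 0)) :=
    (by fun_prop : Continuous fun p : E × F => ((0, p.1, p.2) : E × E × F)).tendsto (0, 0)
  have t2 : Tendsto (fun p : E × F => ((0, p.1) : E × E)) (𝓝 (0, 0)) (𝓝 (0, 0)) :=
    (by fun_prop : Continuous fun p : E × F => ((0, p.1) : E × E)).tendsto (0, 0)
  have t3 : Tendsto (fun p : E × F => a p.1 p.2) (𝓝 (0, 0)) (𝓝 0) := by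
    simpa [ha0] using h.contDiffAt.continuousAt.tendsto
  have t4 : Tendsto (fun p : E × F => p.1) (𝓝 (0, 0)) (𝓝 0) := continuous_fst.tendsto (0, 0)
  filter_upwards [t1.eventually h.act_act.eventually_nhds, t2.eventually (hG.eventually (by simp)),
    t3.eventually h.eventually_contDiffAt, t4.eventually G.zero_mul,
    h.contDiffAt.eventually (by simp)] with p h1 h2 h3 h4 h5 X
  have e : (fun g => a g (a p.1 p.2)) =ᶠ[𝓝 0] fun g => a (G.mul g p.1) p.2 :=
    ((Continuous.prodMk_left (p.1, p.2)).tendsto (0 : E)).eventually h1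
  have d1 : HasFDerivAt (fun g => a g (a p.1 p.2)) _ 0 :=
    HasFDerivAt.comp (0 : E) (g := fun p : E × F => a p.1 p.2) (f := fun g => (g, a p.1 p.2))
      (h3.differentiableAt (by simp)).hasFDerivAt (hasFDerivAt_prodMk_left 0 (a p.1 p.2))
  have dm : HasFDerivAt (fun g => G.mul g p.1) (ThreeWeb.P G.mul (0, p.1)) 0 := by
    rw [ThreeWeb.P_eq h2]
    exact HasFDerivAt.comp (0 : E) (g := fun p : E × E => G.mul p.1 p.2) (f := fun g => (g, p.1))
      (ThreeWeb.hasFDerivAt_jet₀ h2) (hasFDerivAt_prodMk_left 0 p.1)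
  have da : HasFDerivAt (fun p : E × F => a p.1 p.2) (fderiv ℝ (fun p : E × F => a p.1 p.2) p)
      (G.mul 0 p.1, p.2) := by
    rw [h4]
    exact (h5.differentiableAt (by simp)).hasFDerivAt
  have d2 : HasFDerivAt (fun g => a (G.mul g p.1) p.2) _ 0 :=
    HasFDerivAt.comp (0 : E) (g := fun p : E × F => a p.1 p.2) (f := fun g => (G.mul g p.1, p.2))
      da (dm.prodMk (hasFDerivAt_const p.2 0))
  simpa [infAct] using congrArg (fun f => f X) (d1.unique (d2.congr_of_eventuallyEq e))

/-- Differentiate `infAct_act` in the group variable at 0, in the direction Y. The first term on the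
right is symmetric in X and Y, so antisymmetrizing leaves only the bracket. -/
theorem fderiv_infAct : ∀ᶠ z in 𝓝 (0 : F), ∀ X Y,
    fderiv ℝ (infAct a) z (infAct a z Y) X =
      fderiv ℝ (fderiv ℝ (fun p : E × F => a p.1 p.2)) (0, z) (Y, 0) (X, 0)
        + infAct a z (ThreeWeb.mixedDeriv G.mul (0, 0) X Y) := by
  have hG := G.contDiffAt_mul.of_infty
  have t1 : Tendsto (fun z : F => ((0, z) : E × F)) (𝓝 0) (𝓝 (0, 0)) :=
    (Continuous.prodMk_right (0 : E)).tendsto (0 : F)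
  filter_upwards [t1.eventually h.infAct_act.eventually_nhds, h.zero_act, h.eventually_contDiffAt,
    h.eventually_contDiffAt_infAct] with z h1 h2 h3 h4 X Y
  have e : (fun g => infAct a (a g z) X) =ᶠ[𝓝 0] fun g =>
      fderiv ℝ (fun p : E × F => a p.1 p.2) (g, z)
        (ContinuousLinearMap.inl ℝ E F (ThreeWeb.P G.mul (0, g) X)) := by
    filter_upwards [((Continuous.prodMk_left z).tendsto (0 : E)).eventually h1] with g hg
    exact hg X
  have d0 : HasFDerivAt (fun g => a g z) (infAct a z) 0 :=
    HasFDerivAt.comp (0 : E) (g := fun p : E × F => a p.1 p.2) (f := fun g => (g, z))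
      (h3.differentiableAt (by simp)).hasFDerivAt (hasFDerivAt_prodMk_left 0 z)
  have dI : HasFDerivAt (infAct a) (fderiv ℝ (infAct a) z) (a 0 z) := by
    rw [h2]
    exact (h4.differentiableAt (by simp)).hasFDerivAt
  have d1 := (dI.comp (0 : E) d0).clm_apply (hasFDerivAt_const X (0 : E))
  have dP := (((ThreeWeb.hasFDerivAt_P hG).comp (0 : E) (f := fun g : E => ((0 : E), g))
    (hasFDerivAt_prodMk_right (0 : E) (0 : E))).clm_apply (hasFDerivAt_const X (0 : E)))
  have d2 := ((((h3.fderiv_right (m := 3) (by norm_num)).differentiableAt (by simp)).hasFDerivAt.comp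
    (0 : E) (f := fun g : E => (g, z)) (hasFDerivAt_prodMk_left 0 z)).clm_apply
    ((ContinuousLinearMap.inl ℝ E F).hasFDerivAt.comp (0 : E) dP))
  have hP : ThreeWeb.P G.mul (0, 0) X = X := by
    rw [ThreeWeb.P_eq hG, ThreeWeb.jet₁, (EmbeddedLoop.hasFDerivAt_mul G).fderiv]
    simp
  have := congrArg (fun f => f Y) (d1.unique (d2.congr_of_eventuallyEq e))
  simp [hP] at this
  rw [this, ThreeWeb.mixedDeriv_apply hG, ThreeWeb.jet₂_symm hG, infAct, add_comm]
  rfl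

/-- The infinitesimal action is a homomorphism. -/
theorem fderiv_infAct_sub : ∀ᶠ z in 𝓝 (0 : F), ∀ X Y,
    fderiv ℝ (infAct a) z (infAct a z Y) X - fderiv ℝ (infAct a) z (infAct a z X) Y =
      infAct a z (G.bracket X Y) := by
  filter_upwards [h.fderiv_infAct, h.eventually_contDiffAt] with z hz h1 X Y
  rw [hz, hz, (h1.isSymmSndFDerivAt (by simp; norm_num)).eq (X, 0) (Y, 0), LocalLieGroup.bracket,
    map_sub]
  abel

/-- On the diagonal the correction by the mixed derivative of the group product vanishes, the
coordinates being normal. -/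
theorem fderiv_fderiv_act : ∀ᶠ z in 𝓝 (0 : F), ∀ X,
    fderiv ℝ (fderiv ℝ (fun p : E × F => a p.1 p.2)) (0, z) (X, 0) (X, 0) =
      fderiv ℝ (infAct a) z (infAct a z X) X := by
  filter_upwards [h.fderiv_infAct] with z hz X
  rw [hz, G.mixedDeriv_self, map_zero, add_zero]

end IsLocalAction

end Action

/-! ### The web of `a (s x) z` along the leaf `x = 0`. -/

section Section

variable {E F : Type*} [NormedAddCommGroup E] [NormedSpace ℝ E] [NormedAddCommGroup F]
  [NormedSpace ℝ F]

namespace IsLocalAction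

variable {G : LocalLieGroup E} {a : E → F → F} (h : IsLocalAction G a)
  {s : F → E} (hs : ContDiffAt ℝ 4 s 0) (hs0 : s 0 = 0)
include h hs0

theorem Q_comp_section : ∀ᶠ z in 𝓝 (0 : F),
    ThreeWeb.Q (fun x z => a (s x) z) (0, z) = ContinuousLinearMap.id ℝ F := by
  filter_upwards [h.zero_act.eventually_nhds] with z hz
  have e : (fun y => a (s 0) y) =ᶠ[𝓝 z] id := by
    rw [hs0]
    exact hz
  rw [ThreeWeb.Q, e.fderiv_eq]
  exact fderiv_id

include hs

theorem contDiffAt_comp_section :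
    ContDiffAt ℝ 4 (fun p : F × F => a (s p.1) p.2) (0, 0) := by
  refine ContDiffAt.comp (0, 0) (g := fun p : E × F => a p.1 p.2)
    (f := fun p : F × F => (s p.1, p.2)) ?_ ?_
  · simpa [hs0] using h.contDiffAt
  · exact (ContDiffAt.comp ((0, 0) : F × F) (g := s) (f := Prod.fst) hs contDiffAt_fst).prodMk
      contDiffAt_snd

theorem jet₁_comp_section : ∀ᶠ p in 𝓝 ((0, 0) : F × F), ∀ v w : F,
    ThreeWeb.jet₁ (fun x z => a (s x) z) p (v, w) =
      fderiv ℝ (fun p : E × F => a p.1 p.2) (s p.1, p.2) (fderiv ℝ s p.1 v, w) := by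
  have t1 : Tendsto (fun p : F × F => (s p.1, p.2)) (𝓝 (0, 0)) (𝓝 (0, 0)) := by
    have := (ContinuousAt.comp (x := ((0, 0) : F × F)) (f := Prod.fst) (g := s) hs.continuousAt
      continuousAt_fst).prodMk continuousAt_snd
    simpa [ContinuousAt, hs0] using this
  filter_upwards [t1.eventually (h.contDiffAt.eventually (by simp)),
    (continuous_fst.tendsto ((0, 0) : F × F)).eventually (hs.eventually (by simp))] with p h1 h2 v w
  have d1 : HasFDerivAt (fun p : F × F => (s p.1, p.2)) _ p :=
    (HasFDerivAt.comp p (g := s) (f := Prod.fst) (h2.differentiableAt (by simp)).hasFDerivAt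
      hasFDerivAt_fst).prodMk hasFDerivAt_snd
  have d2 := HasFDerivAt.comp p (g := fun p : E × F => a p.1 p.2)
    (f := fun p : F × F => (s p.1, p.2)) (h1.differentiableAt (by simp)).hasFDerivAt d1
  have := d2.fderiv
  simp only [Function.comp_def] at this
  rw [ThreeWeb.jet₁, this]
  simp

theorem P_comp_section : ∀ᶠ z in 𝓝 (0 : F),
    ThreeWeb.P (fun x z => a (s x) z) (0, z) = infAct a z ∘L fderiv ℝ s 0 := by
  have t1 : Tendsto (fun z : F => ((0, z) : F × F)) (𝓝 0) (𝓝 (0, 0)) :=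
    (Continuous.prodMk_right (0 : F)).tendsto (0 : F)
  filter_upwards [t1.eventually (h.jet₁_comp_section hs hs0),
    t1.eventually ((h.contDiffAt_comp_section hs hs0).eventually (by simp))] with z h1 h2
  ext v
  rw [ThreeWeb.P_eq h2]
  simp [h1, infAct, hs0]

theorem jet₂_comp_section_snd_snd : ∀ᶠ z in 𝓝 (0 : F), ∀ v w : F,
    ThreeWeb.jet₂ (fun x z => a (s x) z) (0, z) (0, v) (0, w) = 0 := by
  have t1 : Tendsto (fun z : F => ((0, z) : F × F)) (𝓝 0) (𝓝 (0, 0)) :=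
    (Continuous.prodMk_right (0 : F)).tendsto (0 : F)
  filter_upwards [(h.Q_comp_section hs0).eventually_nhds,
    t1.eventually ((h.contDiffAt_comp_section hs hs0).eventually (by simp))] with z h1 h2 v w
  have d1 := (((ThreeWeb.hasFDerivAt_Q (μ := fun x z => a (s x) z) h2).comp z (f := fun z : F => ((0 : F), z))
    (hasFDerivAt_prodMk_right (0 : F) z))).clm_apply (hasFDerivAt_const w z)
  have e : (fun z : F => ThreeWeb.Q (fun x z => a (s x) z) (0, z) w) =ᶠ[𝓝 z] fun _ => w :=
    h1.mono fun q hq => by simp [hq]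
  simpa using congrArg (fun f => f v) (d1.unique ((hasFDerivAt_const w z).congr_of_eventuallyEq e))

theorem jet₂_comp_section_snd_fst : ∀ᶠ z in 𝓝 (0 : F), ∀ v w : F,
    ThreeWeb.jet₂ (fun x z => a (s x) z) (0, z) (0, v) (w, 0) =
      fderiv ℝ (infAct a) z v (fderiv ℝ s 0 w) := by
  have t1 : Tendsto (fun z : F => ((0, z) : F × F)) (𝓝 0) (𝓝 (0, 0)) :=
    (Continuous.prodMk_right (0 : F)).tendsto (0 : F)
  filter_upwards [(h.P_comp_section hs hs0).eventually_nhds, h.eventually_contDiffAt_infAct,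
    t1.eventually ((h.contDiffAt_comp_section hs hs0).eventually (by simp))] with z h1 h3 h2 v w
  have d1 := (((ThreeWeb.hasFDerivAt_P (μ := fun x z => a (s x) z) h2).comp z (f := fun z : F => ((0 : F), z))
    (hasFDerivAt_prodMk_right (0 : F) z))).clm_apply (hasFDerivAt_const w z)
  have d2 := (h3.differentiableAt (by simp)).hasFDerivAt.clm_apply
    (hasFDerivAt_const (fderiv ℝ s 0 w) z)
  have e : (fun z : F => ThreeWeb.P (fun x z => a (s x) z) (0, z) w) =ᶠ[𝓝 z] fun z =>
      infAct a z (fderiv ℝ s 0 w) :=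
    h1.mono fun q hq => by simp [hq]
  simpa using congrArg (fun f => f v) (d1.unique (d2.congr_of_eventuallyEq e))

/-- Second-order chain rule: one term comes from the action along ιv, the other from the bending
S(v,v) of the section. -/
theorem jet₂_comp_section_fst_fst : ∀ᶠ z in 𝓝 (0 : F), ∀ v : F,
    ThreeWeb.jet₂ (fun x z => a (s x) z) (0, z) (v, 0) (v, 0) =
      fderiv ℝ (infAct a) z (infAct a z (fderiv ℝ s 0 v)) (fderiv ℝ s 0 v)
        + infAct a z (fderiv ℝ (fderiv ℝ s) 0 v v) := by
  have t1 : Tendsto (fun z : F => ((0, z) : F × F)) (𝓝 0) (𝓝 (0, 0)) :=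
    (Continuous.prodMk_right (0 : F)).tendsto (0 : F)
  filter_upwards [t1.eventually (h.jet₁_comp_section hs hs0).eventually_nhds,
    h.eventually_contDiffAt, h.fderiv_fderiv_act,
    t1.eventually ((h.contDiffAt_comp_section hs hs0).eventually (by simp))] with z h1 h3 h4 h2 v
  have d1 := ((ThreeWeb.hasFDerivAt_jet₁ (μ := fun x z => a (s x) z) h2).comp (0 : F) (f := fun x : F => (x, z))
    (hasFDerivAt_prodMk_left (0 : F) z)).clm_apply (hasFDerivAt_const ((v, 0) : F × F) (0 : F))
  have ds : HasFDerivAt (fderiv ℝ s) (fderiv ℝ (fderiv ℝ s) 0) 0 :=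
    ((hs.fderiv_right (m := 3) (by norm_num)).differentiableAt (by simp)).hasFDerivAt
  have da : HasFDerivAt (fderiv ℝ (fun p : E × F => a p.1 p.2))
      (fderiv ℝ (fderiv ℝ (fun p : E × F => a p.1 p.2)) (0, z)) (s 0, z) := by
    rw [hs0]
    exact ((h3.fderiv_right (m := 3) (by norm_num)).differentiableAt (by simp)).hasFDerivAt
  have dsz : HasFDerivAt (fun x => (s x, z)) _ 0 :=
    (hs.differentiableAt (by simp)).hasFDerivAt.prodMk (hasFDerivAt_const z (0 : F))
  have d2 := (HasFDerivAt.comp (0 : F) (f := fun x : F => (s x, z)) da dsz).clm_apply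
    ((ContinuousLinearMap.inl ℝ E F).hasFDerivAt.comp (0 : F)
      (ds.clm_apply (hasFDerivAt_const v (0 : F))))
  have e : (fun x : F => ThreeWeb.jet₁ (fun x z => a (s x) z) (x, z) (v, 0)) =ᶠ[𝓝 0] fun x =>
      fderiv ℝ (fun p : E × F => a p.1 p.2) (s x, z)
        (ContinuousLinearMap.inl ℝ E F (fderiv ℝ s x v)) := by
    filter_upwards [((Continuous.prodMk_left z).tendsto (0 : F)).eventually h1] with x hx
    exact hx v 0
  have := congrArg (fun f => f v) (d1.unique (d2.congr_of_eventuallyEq e))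
  simp [hs0] at this
  rw [this, ← h4, infAct, add_comm]
  rfl

set_option maxSynthPendingDepth 6 in
-- The second-order identity holds at all nearby points of the leaf, so it may be differentiated
-- along it.
theorem jet₃_comp_section : ∀ᶠ z in 𝓝 (0 : F), ∀ v w : F,
    ThreeWeb.jet₃ (fun x z => a (s x) z) (0, z) (0, w) (v, 0) (v, 0) =
      fderiv ℝ (fderiv ℝ (infAct a)) z w (infAct a z (fderiv ℝ s 0 v)) (fderiv ℝ s 0 v)
        + fderiv ℝ (infAct a) z (fderiv ℝ (infAct a) z w (fderiv ℝ s 0 v)) (fderiv ℝ s 0 v)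
        + fderiv ℝ (infAct a) z w (fderiv ℝ (fderiv ℝ s) 0 v v) := by
  have t1 : Tendsto (fun z : F => ((0, z) : F × F)) (𝓝 0) (𝓝 (0, 0)) :=
    (Continuous.prodMk_right (0 : F)).tendsto (0 : F)
  filter_upwards [(h.jet₂_comp_section_fst_fst hs hs0).eventually_nhds,
    h.eventually_contDiffAt_infAct,
    t1.eventually ((h.contDiffAt_comp_section hs hs0).eventually (by simp))] with z h1 h3 h2 v w
  have d0 := (((ThreeWeb.hasFDerivAt_jet₂ (μ := fun x z => a (s x) z) h2).comp z (f := fun z : F => ((0 : F), z))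
    (hasFDerivAt_prodMk_right (0 : F) z))
    |>.clm_apply (hasFDerivAt_const ((v, 0) : F × F) z))
  have d1 := d0.clm_apply (hasFDerivAt_const ((v, 0) : F × F) z)
  have dI := (h3.differentiableAt (by simp)).hasFDerivAt
  have dI2 := ((h3.fderiv_right (m := 2) (by norm_num)).differentiableAt (by simp)).hasFDerivAt
  have c (X : E) : HasFDerivAt (fun _ : F => X) (0 : F →L[ℝ] E) z := hasFDerivAt_const X z
  have d2 := ((dI2.clm_apply (dI.clm_apply (c (fderiv ℝ s 0 v)))).clm_apply
    (c (fderiv ℝ s 0 v))).add (dI.clm_apply (c (fderiv ℝ (fderiv ℝ s) 0 v v)))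
  have e := h1.mono fun q hq => hq v
  have := congrArg (fun f => f w) (d1.unique (d2.congr_of_eventuallyEq e))
  simp at this
  rw [this]
  abel

set_option maxSynthPendingDepth 6 in
theorem jet₃_comp_section' : ∀ᶠ z in 𝓝 (0 : F), ∀ v w : F,
    ThreeWeb.jet₃ (fun x z => a (s x) z) (0, z) (0, w) (v, 0) (0, w) =
      fderiv ℝ (fderiv ℝ (infAct a)) z w w (fderiv ℝ s 0 v) := by
  have t1 : Tendsto (fun z : F => ((0, z) : F × F)) (𝓝 0) (𝓝 (0, 0)) :=
    (Continuous.prodMk_right (0 : F)).tendsto (0 : F)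
  filter_upwards [(h.jet₂_comp_section_snd_fst hs hs0).eventually_nhds,
    h.eventually_contDiffAt_infAct,
    t1.eventually ((h.contDiffAt_comp_section hs hs0).eventually (by simp))] with z h1 h3 h2 v w
  rw [ThreeWeb.jet₃_symm_right (μ := fun x z => a (s x) z) h2]
  have d0 := (((ThreeWeb.hasFDerivAt_jet₂ (μ := fun x z => a (s x) z) h2).comp z (f := fun z : F => ((0 : F), z))
    (hasFDerivAt_prodMk_right (0 : F) z))
    |>.clm_apply (hasFDerivAt_const ((0, w) : F × F) z))
  have d1 := d0.clm_apply (hasFDerivAt_const ((v, 0) : F × F) z)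
  have d2 := ((((h3.fderiv_right (m := 2) (by norm_num)).differentiableAt
    (by simp)).hasFDerivAt.clm_apply (hasFDerivAt_const w z))).clm_apply
    (hasFDerivAt_const (fderiv ℝ s 0 v) z)
  have e := h1.mono fun q hq => hq w v
  simpa using congrArg (fun f => f w) (d1.unique (d2.congr_of_eventuallyEq e))

theorem regularAt_comp_section (hi : infAct a 0 ∘L fderiv ℝ s 0 = ContinuousLinearMap.id ℝ F) :
    ThreeWeb.RegularAt (fun x z => a (s x) z) (0, 0) := by
  refine ⟨h.contDiffAt_comp_section hs hs0, ?_, ?_⟩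
  · rw [(h.P_comp_section hs hs0).self_of_nhds, hi]
    exact ⟨ContinuousLinearEquiv.refl ℝ F, rfl⟩
  · rw [(h.Q_comp_section hs0).self_of_nhds]
    exact ⟨ContinuousLinearEquiv.refl ℝ F, rfl⟩

/-- The curvature on the diagonal, at the points of the leaf `x = 0`. -/
theorem b_comp_section [CompleteSpace F]
    (hi : infAct a 0 ∘L fderiv ℝ s 0 = ContinuousLinearMap.id ℝ F) :
    ∀ᶠ z in 𝓝 (0 : F), (infAct a z ∘L fderiv ℝ s 0).IsInvertible ∧ ∀ ξ v : F,
      v = (infAct a z ∘L fderiv ℝ s 0).inverse ξ →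
      ThreeWeb.b (fun x z => a (s x) z) (0, z) ξ ξ ξ =
        -infAct a z (G.bracket (fderiv ℝ (fderiv ℝ s) 0 v v - fderiv ℝ s 0
          ((infAct a z ∘L fderiv ℝ s 0).inverse (infAct a z (fderiv ℝ (fderiv ℝ s) 0 v v))))
          (fderiv ℝ s 0 v)) := by
  have t1 : Tendsto (fun z : F => ((0, z) : F × F)) (𝓝 0) (𝓝 (0, 0)) :=
    (Continuous.prodMk_right (0 : F)).tendsto (0 : F)
  filter_upwards [t1.eventually (h.regularAt_comp_section hs hs0 hi).eventually,
    h.P_comp_section hs hs0, h.Q_comp_section hs0, h.jet₂_comp_section_snd_snd hs hs0,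
    h.jet₂_comp_section_snd_fst hs hs0, h.jet₂_comp_section_fst_fst hs hs0,
    h.jet₃_comp_section hs hs0, h.jet₃_comp_section' hs hs0, h.fderiv_infAct_sub]
    with z hz hP hQ j1 j2 j3 j4 j5 hbr
  have hinv := hz.isInvertible_P
  rw [hP] at hinv
  refine ⟨hinv, fun ξ v hv => ?_⟩
  have hc := hz.contDiffAt
  have hξ : infAct a z (fderiv ℝ s 0 v) = ξ := by
    rw [hv]
    exact hinv.self_apply_inverse ξ
  -- As K lies in ker ρ_z, the homomorphism identity reduces ρ_z[K, ιv] to Dρ_z(ξ)K. In the expanded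
  -- curvature the D²ρ terms and the terms with two factors Dρ cancel in pairs, leaving exactly
  -- -Dρ_z(ξ)K.
  have hK : infAct a z (fderiv ℝ (fderiv ℝ s) 0 v v - fderiv ℝ s 0
      ((infAct a z ∘L fderiv ℝ s 0).inverse (infAct a z (fderiv ℝ (fderiv ℝ s) 0 v v)))) = 0 := by
    rw [map_sub, sub_eq_zero]
    exact (hinv.self_apply_inverse _).symm
  rw [← hbr, hK, map_zero, zero_apply, sub_zero, hξ, hz.b_eq, hP, hQ]
  simp only [ContinuousLinearMap.inverse_id, ContinuousLinearMap.id_apply, ← hv, j1, j3,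
    ThreeWeb.jet₂_symm (μ := fun x z => a (s x) z) hc (_, 0) (0, _), j2, ThreeWeb.jet₃_symm_right (μ := fun x z => a (s x) z) hc (v, 0) (v, 0) (0, _),
    ThreeWeb.jet₃_symm_left (μ := fun x z => a (s x) z) hc (v, 0) (0, _), j4, j5, hξ]
  simp only [map_add, map_sub, map_zero, zero_apply]
  abel

end IsLocalAction

end Section

/-! ### The bracket as a bilinear map, and the two conditions at the base point. -/

namespace LocalLieGroup

variable {E : Type*} [NormedAddCommGroup E] [NormedSpace ℝ E] (G : LocalLieGroup E)

/-- The Lie bracket as a continuous bilinear map. -/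
noncomputable def bracketL : E →L[ℝ] E →L[ℝ] E :=
  ThreeWeb.mixedDeriv G.mul (0, 0) - (ThreeWeb.mixedDeriv G.mul (0, 0)).flip

theorem bracketL_apply (X Y : E) : G.bracketL X Y = G.bracket X Y := rfl

theorem bracket_skew (X Y : E) : G.bracket X Y = -G.bracket Y X := by
  simp [bracket]

end LocalLieGroup

namespace IsLocalAction

variable {E F : Type*} [NormedAddCommGroup E] [NormedSpace ℝ E] [NormedAddCommGroup F]
  [NormedSpace ℝ F] [CompleteSpace F] {G : LocalLieGroup E} {a : E → F → F}
  (h : IsLocalAction G a) {s : F → E} (hs : ContDiffAt ℝ 4 s 0) (hs0 : s 0 = 0)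
  (hi : infAct a 0 ∘L fderiv ℝ s 0 = ContinuousLinearMap.id ℝ F)
  (hS : ∀ v w, infAct a 0 (fderiv ℝ (fderiv ℝ s) 0 v w) = 0)
include h hs hs0 hi hS

/-- At the origin P = id and ρ₀S = 0, so K = S(v,v). -/
theorem symBVanishesAt_iff : ThreeWeb.SymBVanishesAt (fun x z => a (s x) z) (0, 0) ↔
    ∀ v, infAct a 0 (G.bracket (fderiv ℝ (fderiv ℝ s) 0 v v) (fderiv ℝ s 0 v)) = 0 := by
  rw [(h.regularAt_comp_section hs hs0 hi).symBVanishesAt_iff]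
  refine forall_congr' fun v => ?_
  have hb := (h.b_comp_section hs hs0 hi).self_of_nhds.2 v v
  simp only [hi, hS, ContinuousLinearMap.inverse_id, ContinuousLinearMap.id_apply, map_zero,
    sub_zero, true_imp_iff] at hb
  rw [hb, neg_eq_zero]

/-- The derivative at `t = 0` of ρ[K, ιv(t)] at `z = tτ`, with P v(t) = v, must vanish. It has three
sources: ρ itself gives the double bracket, the correction in K gives the nested projection, and the
variation of v(t) drops out. -/
theorem of_symBVanishesAt_of_symDVanishesAt
    (hB : ThreeWeb.SymBVanishesAt (fun x z => a (s x) z) (0, 0))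
    (hD : ThreeWeb.SymDVanishesAt (fun x z => a (s x) z) (0, 0)) (v τ : F) :
    infAct a 0 (G.bracket (fderiv ℝ s 0 τ)
        (G.bracket (fderiv ℝ (fderiv ℝ s) 0 v v) (fderiv ℝ s 0 v))
      - G.bracket (fderiv ℝ s 0 (infAct a 0
          (G.bracket (fderiv ℝ s 0 τ) (fderiv ℝ (fderiv ℝ s) 0 v v)))) (fderiv ℝ s 0 v)) = 0 := by
  have hreg := h.regularAt_comp_section hs hs0 hi
  set S := fderiv ℝ (fderiv ℝ s) 0 with hSdef
  set ι := fderiv ℝ s 0 with hι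
  have hi' (x : F) : infAct a 0 (ι x) = x := congrArg (fun f => f x) hi
  have hB' := (h.symBVanishesAt_iff hs hs0 hi hS).1 hB
  simp only [← hSdef, ← hι] at hB'
  have hsymm (x y : F) : S x y = S y x := (hs.isSymmSndFDerivAt (by simp; norm_num)).eq x y
  -- the derivative of the curvature along the curve `t ↦ (0, t τ)`
  have htend : Tendsto (fun t : ℝ => t • τ) (𝓝 0) (𝓝 0) := by
    simpa using (tendsto_id (α := ℝ) (x := 𝓝 0)).smul_const τ
  have hd0 : HasDerivAt (fun t : ℝ => ThreeWeb.b (fun x z => a (s x) z) (0, t • τ) v v v) 0 0 := by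
    have h1 := hD v v v τ
    rw [hB.sym₃_d hreg] at h1
    simp only [ThreeWeb.sym₃_diag, ThreeWeb.frame₂, (h.Q_comp_section hs0).self_of_nhds,
      ContinuousLinearMap.inverse_id, ContinuousLinearMap.id_apply] at h1
    have h2 : HasDerivAt (fun t : ℝ => ((0, t • τ) : F × F)) (0, τ) 0 := by
      simpa using (hasDerivAt_const (0 : ℝ) (0 : F)).prodMk ((hasDerivAt_id (0 : ℝ)).smul_const τ)
    have h3 := HasFDerivAt.comp_hasDerivAt_of_eq (0 : ℝ)
      (hreg.differentiableAt_b v v v).hasFDerivAt h2 (by simp)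
    rw [h1] at h3
    exact h3
  have hI : HasDerivAt (fun t : ℝ => infAct a (t • τ)) (fderiv ℝ (infAct a) 0 τ) 0 := by
    have h2 : HasDerivAt (fun t : ℝ => t • τ) τ 0 := by
      simpa using (hasDerivAt_id (0 : ℝ)).smul_const τ
    exact HasFDerivAt.comp_hasDerivAt_of_eq (0 : ℝ)
      (h.eventually_contDiffAt_infAct.self_of_nhds.differentiableAt (by simp)).hasFDerivAt h2
      (by simp)
  have hT : HasDerivAt (fun t : ℝ => infAct a (t • τ) ∘L ι) (fderiv ℝ (infAct a) 0 τ ∘L ι) 0 := by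
    simpa using hI.clm_comp (hasDerivAt_const (0 : ℝ) ι)
  have hinv0 : (infAct a ((0 : ℝ) • τ) ∘L ι).IsInvertible := by
    rw [zero_smul, hi]
    exact ⟨ContinuousLinearEquiv.refl ℝ F, rfl⟩
  have hN : DifferentiableAt ℝ (fun t : ℝ => (infAct a (t • τ) ∘L ι).inverse) 0 :=
    hT.differentiableAt.clm_inverse hinv0
  have hev := htend.eventually (h.b_comp_section hs hs0 hi)
  simp only [← hSdef, ← hι] at hev
  -- The value of w is never needed: its total contribution vanishes by `hpol`.
  obtain ⟨w, hw⟩ : ∃ w, HasDerivAt (fun t : ℝ => (infAct a (t • τ) ∘L ι).inverse v) w 0 :=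
    ⟨_, (hN.clm_apply (differentiableAt_const v)).hasDerivAt⟩
  have hSt := ((hasDerivAt_const (0 : ℝ) S).clm_apply hw).clm_apply hw
  have hISt := hI.clm_apply hSt
  obtain ⟨r, hr⟩ : ∃ r, HasDerivAt (fun t : ℝ => (infAct a (t • τ) ∘L ι).inverse (infAct a (t • τ)
      (S ((infAct a (t • τ) ∘L ι).inverse v) ((infAct a (t • τ) ∘L ι).inverse v)))) r 0 :=
    ⟨_, (hN.clm_apply hISt.differentiableAt).hasDerivAt⟩
  -- Differentiate P(P⁻¹ρS) = ρS; the terms with P′ and with w vanish because ρ₀ kills the values of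
  -- S.
  have hr' : r = fderiv ℝ (infAct a) 0 τ (S v v) := by
    have h1 := hT.clm_apply hr
    have h2 := h1.unique (hISt.congr_of_eventuallyEq
      (hev.mono fun t ht => ht.1.self_apply_inverse _))
    simpa [hi, hi', hS] using h2
  have hBr := (hasDerivAt_const (0 : ℝ) G.bracketL).clm_apply
    (hSt.sub ((hasDerivAt_const (0 : ℝ) ι).clm_apply hr))
  have hb := (hI.clm_apply (hBr.clm_apply ((hasDerivAt_const (0 : ℝ) ι).clm_apply hw))).neg
  have key := hb.unique (hd0.congr_of_eventuallyEq
    (hev.mono fun t ht => (ht.2 v _ rfl).symm))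
  -- Used for X = S(v,v), and for X = [S(v,v), ιv], which lies in ker ρ₀ precisely by the condition
  -- on b.
  have hL (X : E) (hX : infAct a 0 X = 0) :
      fderiv ℝ (infAct a) 0 τ X = infAct a 0 (G.bracketL X (ι τ)) := by
    have := h.fderiv_infAct_sub.self_of_nhds X (ι τ)
    rwa [hi', hX, map_zero, zero_apply, sub_zero] at this
  -- Polarizing the condition on b at (w,v,v) gives 2ρ₀[S(v,w), ιv] + ρ₀[S(v,v), ιw] = 0, up to a
  -- factor 2: exactly the w-terms of `key`.
  have hpol := sum_perm_eq_zero_of_diag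
    (f := fun x y z => infAct a 0 (G.bracketL (S x y) (ι z))) (by simp) (by simp) (by simp) hB' w v v
  have hskew (X Y : E) : G.bracketL X Y = -G.bracketL Y X := G.bracket_skew X Y
  simp only [hsymm w v] at hpol
  simp only [← G.bracketL_apply] at hB' ⊢
  simp [hi, hS] at key
  rw [hL _ (hB' v), hr', hL _ (hS v v), hsymm w v, hskew _ (ι τ), hskew _ (ι τ)] at key
  simp only [map_sub, map_neg, neg_apply] at key ⊢
  linear_combination (norm := module) key + (1 / 2 : ℝ) • hpol

end IsLocalAction

/-- Symmetry in the first two slots makes the sum over six permutations twice the cyclic sum. -/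
theorem forall_diag_eq_zero_iff_cyclic_sum {A B : Type*} [AddCommGroup A] [AddCommGroup B]
    [Module ℝ B] {f : A → A → A → B} (hf : ∀ a b c, f a b c = f b a c)
    (h₂ : ∀ a b b' c, f a (b + b') c = f a b c + f a b' c)
    (h₃ : ∀ a b c c', f a b (c + c') = f a b c + f a b c') :
    (∀ a, f a a a = 0) ↔ ∀ x y z, f x y z + f y z x + f z x y = 0 := by
  refine ⟨fun H x y z => ?_, fun H a => ?_⟩
  · have := sum_perm_eq_zero_of_diag
      (fun a a' b c => by rw [hf, h₂, hf, hf b]) h₂ h₃ H x y z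
    rw [hf y x, hf x z, hf z y] at this
    linear_combination (norm := module) (1 / 2 : ℝ) • this
  · linear_combination (norm := module) (1 / 3 : ℝ) • H a a a

/-! ### The embedded loop as a section acting on the local coset space. -/

namespace EmbeddedLoop

variable {E : Type*} [NormedAddCommGroup E] [NormedSpace ℝ E] (L : EmbeddedLoop E)

theorem fderiv_sec_zero : fderiv ℝ L.sec 0 = L.V.subtypeL := L.hasFDerivAt_sec.fderiv

theorem fderiv_fderiv_sec_zero (v w : L.V) :
    fderiv ℝ (fderiv ℝ L.sec) 0 v w = (2 : ℝ) • (L.R v w : E) := by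
  have hφ := L.contDiffAt_φ.of_infty
  have e : fderiv ℝ L.sec =ᶠ[𝓝 0] fun z =>
      L.V.subtypeL + L.𝔥.subtypeL.postcomp L.V (fderiv ℝ L.φ z) := by
    filter_upwards [hφ.eventually (by simp)] with z hz
    exact (L.V.subtypeL.hasFDerivAt.add (L.𝔥.subtypeL.hasFDerivAt.comp z
      (hz.differentiableAt (by simp)).hasFDerivAt)).fderiv
  have d2 := ((L.𝔥.subtypeL.postcomp L.V).hasFDerivAt.comp (0 : L.V)
    ((hφ.fderiv_right (m := 3) (by norm_num)).differentiableAt (by simp)).hasFDerivAt).const_add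
    L.V.subtypeL
  rw [(d2.congr_of_eventuallyEq e).fderiv]
  simp [R]

theorem R_add_right (ξ η η' : L.V) : L.R ξ (η + η') = L.R ξ η + L.R ξ η' := by simp [R]

theorem R_symm (ξ η : L.V) : L.R ξ η = L.R η ξ := by
  rw [R, (L.contDiffAt_φ.of_infty.isSymmSndFDerivAt (by simp; norm_num)).eq ξ η, R]

theorem secMul_zero : L.secMul 0 = 0 := by
  simpa [secMul, L.sec_zero] using L.G.mul_zero.self_of_nhds

theorem mul_zero_zero : L.G.mul 0 0 = 0 := L.G.mul_zero.self_of_nhds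

theorem continuousAt_mul_comp {X : Type*} [TopologicalSpace X] {f g : X → E} {x : X}
    (hf : ContinuousAt f x) (hg : ContinuousAt g x) (hf0 : f x = 0) (hg0 : g x = 0) :
    ContinuousAt (fun y => L.G.mul (f y) (g y)) x :=
  ContinuousAt.comp_of_eq (g := fun p : E × E => L.G.mul p.1 p.2)
    L.G.contDiffAt_mul.continuousAt (hf.prodMk hg) (by simp [hf0, hg0])

theorem proj_coe_𝔥 (h : L.𝔥) : L.proj (h : E) = 0 := Submodule.projectionOnto_apply_right _ h

theorem proj_coe_V (v : L.V) : L.proj (v : E) = v := Submodule.projectionOnto_apply_left _ v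

variable [FiniteDimensional ℝ E]

/-- The coordinates in `Q × H` of a point of `G`. -/
noncomputable def factor : E → L.V × L.𝔥 :=
  haveI : CompleteSpace (L.V × L.𝔥) := FiniteDimensional.complete ℝ (L.V × L.𝔥)
  L.contDiffAt_secMul.localInverse L.hasFDerivAt_secMul (by simp)

theorem projQ_eq (g : E) : L.projQ g = (L.factor g).1 := rfl

theorem contDiffAt_factor : ContDiffAt ℝ ∞ L.factor 0 := by
  have : CompleteSpace (L.V × L.𝔥) := FiniteDimensional.complete ℝ (L.V × L.𝔥)
  have := L.contDiffAt_secMul.to_localInverse L.hasFDerivAt_secMul (by simp)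
  rwa [L.secMul_zero] at this

theorem eventually_factor_secMul : ∀ᶠ p in 𝓝 (0 : L.V × L.𝔥), L.factor (L.secMul p) = p :=
  haveI : CompleteSpace (L.V × L.𝔥) := FiniteDimensional.complete ℝ (L.V × L.𝔥)
  (L.contDiffAt_secMul.hasStrictFDerivAt' L.hasFDerivAt_secMul (by simp)).eventually_left_inverse

theorem eventually_secMul_factor : ∀ᶠ g in 𝓝 (0 : E), L.secMul (L.factor g) = g := by
  have : CompleteSpace (L.V × L.𝔥) := FiniteDimensional.complete ℝ (L.V × L.𝔥)
  have := (L.contDiffAt_secMul.hasStrictFDerivAt' L.hasFDerivAt_secMul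
    (by simp)).eventually_right_inverse
  rwa [L.secMul_zero] at this

theorem factor_zero : L.factor 0 = 0 := by
  simpa [L.secMul_zero] using L.eventually_factor_secMul.self_of_nhds

theorem hasFDerivAt_factor :
    HasFDerivAt L.factor (L.decomp.symm : E →L[ℝ] L.V × L.𝔥) 0 := by
  have : CompleteSpace (L.V × L.𝔥) := FiniteDimensional.complete ℝ (L.V × L.𝔥)
  have := (L.contDiffAt_secMul.hasStrictFDerivAt' L.hasFDerivAt_secMul (by simp)).to_localInverse
  rw [L.secMul_zero] at this
  exact this.hasFDerivAt

theorem decomp_symm_fst (X : E) : (L.decomp.symm X).1 = L.proj X := by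
  obtain ⟨p, rfl⟩ := L.decomp.surjective X
  have : L.decomp p = (p.1 : E) + (p.2 : E) := Submodule.coe_prodEquivOfIsCompl' _ _ L.isCompl p
  rw [L.decomp.symm_apply_apply, this, proj, map_add, Submodule.projectionOnto_apply_left,
    Submodule.projectionOnto_apply_right, add_zero]

theorem decomp_symm_of_mem {X : E} (hX : X ∈ L.𝔥) : (L.decomp.symm X).2 = ⟨X, hX⟩ := by
  have : L.decomp (0, ⟨X, hX⟩) = X := by
    refine (Submodule.coe_prodEquivOfIsCompl' _ _ L.isCompl _).trans ?_
    simp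
  conv_lhs => rw [← this, L.decomp.symm_apply_apply]

/-- The action of `G` on `G / H`, in the coordinates of `Q`. -/
noncomputable def act (g : E) (z : L.V) : L.V := L.projQ (L.G.mul g (L.sec z))

theorem contDiffAt_act : ContDiffAt ℝ ∞ (fun p : E × L.V => L.act p.1 p.2) (0, 0) := by
  have h1 : ContDiffAt ℝ ∞ (fun p : E × L.V => (p.1, L.sec p.2)) (0, 0) :=
    contDiffAt_fst.prodMk (ContDiffAt.comp ((0, 0) : E × L.V) (g := L.sec) (f := Prod.snd)
      L.contDiffAt_sec contDiffAt_snd)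
  have h2 : ContDiffAt ℝ ∞ (fun p : E × L.V => L.G.mul p.1 (L.sec p.2)) (0, 0) := by
    refine ContDiffAt.comp ((0, 0) : E × L.V) (g := fun p : E × E => L.G.mul p.1 p.2)
      (f := fun p : E × L.V => (p.1, L.sec p.2)) ?_ h1
    simpa [L.sec_zero] using L.G.contDiffAt_mul
  refine contDiffAt_fst.comp ((0, 0) : E × L.V) (ContDiffAt.comp ((0, 0) : E × L.V)
    (g := L.factor) (f := fun p : E × L.V => L.G.mul p.1 (L.sec p.2)) ?_ h2)
  simpa [L.sec_zero, L.mul_zero_zero] using L.contDiffAt_factor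

theorem zero_act : ∀ᶠ z in 𝓝 (0 : L.V), L.act 0 z = z := by
  have ts : Tendsto L.sec (𝓝 0) (𝓝 0) := by
    simpa [L.sec_zero] using L.contDiffAt_sec.continuousAt.tendsto
  have t1 : Tendsto (fun z : L.V => ((z, 0) : L.V × L.𝔥)) (𝓝 0) (𝓝 0) :=
    (Continuous.prodMk_left (0 : L.𝔥)).tendsto (0 : L.V)
  filter_upwards [ts.eventually L.G.zero_mul, ts.eventually L.G.mul_zero,
    t1.eventually L.eventually_factor_secMul] with z h1 h2 h3
  have : L.secMul (z, 0) = L.sec z := by simpa [secMul] using h2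
  rw [act, h1, projQ_eq, ← this, h3]

/-- If g₂ s(z) = q h and g₁ q = q′ h′, then g₁g₂ s(z) = q′(h′h), and h′h stays in the subgroup; so
both sides have coordinate q′. The rest checks that every point stays in the domains of the local
identities. -/
theorem act_act : ∀ᶠ p in 𝓝 ((0, 0, 0) : E × E × L.V),
    L.act p.1 (L.act p.2.1 p.2.2) = L.act (L.G.mul p.1 p.2.1) p.2.2 := by
  let k : E × E × L.V → E := fun p => L.G.mul p.2.1 (L.sec p.2.2)
  let q : E × E × L.V → L.V × L.𝔥 := fun p => L.factor (k p)
  let k' : E × E × L.V → E := fun p => L.G.mul p.1 (L.sec (q p).1)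
  let q' : E × E × L.V → L.V × L.𝔥 := fun p => L.factor (k' p)
  let m : E × E × L.V → E := fun p => L.G.mul (q' p).2 (q p).2
  have hsec0 := L.sec_zero
  have hm0 := L.mul_zero_zero
  have hf0 := L.factor_zero
  have hk0 : k (0, 0, 0) = 0 := by simp [k, hsec0, hm0]
  have hq0 : q (0, 0, 0) = 0 := by simp [q, hk0, hf0]
  have hk0' : k' (0, 0, 0) = 0 := by simp [k', hq0, hsec0, hm0]
  have hq0' : q' (0, 0, 0) = 0 := by simp [q', hk0', hf0]
  have hmm0 : m (0, 0, 0) = 0 := by simp [m, hq0, hq0', hm0]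
  have cs := L.contDiffAt_sec.continuousAt
  have cf := L.contDiffAt_factor.continuousAt
  have c1 : ContinuousAt (fun p : E × E × L.V => p.1) (0, 0, 0) := continuousAt_fst
  have c2 : ContinuousAt (fun p : E × E × L.V => p.2.1) (0, 0, 0) := by fun_prop
  have c3 : ContinuousAt (fun p : E × E × L.V => L.sec p.2.2) (0, 0, 0) :=
    ContinuousAt.comp (f := fun p : E × E × L.V => p.2.2) (g := L.sec) cs (by fun_prop)
  have ck : ContinuousAt k (0, 0, 0) := L.continuousAt_mul_comp c2 c3 rfl hsec0
  have cq : ContinuousAt q (0, 0, 0) := cf.comp_of_eq ck hk0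
  have csq : ContinuousAt (fun p => L.sec (q p).1) (0, 0, 0) :=
    ContinuousAt.comp_of_eq (f := fun p => (q p).1) (g := L.sec) cs cq.fst (by simp [hq0])
  have ck' : ContinuousAt k' (0, 0, 0) := L.continuousAt_mul_comp c1 csq rfl (by simp [hq0, hsec0])
  have cq' : ContinuousAt q' (0, 0, 0) := cf.comp_of_eq ck' hk0'
  have csq' : ContinuousAt (fun p => L.sec (q' p).1) (0, 0, 0) :=
    ContinuousAt.comp_of_eq (f := fun p => (q' p).1) (g := L.sec) cs cq'.fst (by simp [hq0'])
  have ch : ContinuousAt (fun p => ((q p).2 : E)) (0, 0, 0) :=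
    continuous_subtype_val.continuousAt.comp cq.snd
  have ch' : ContinuousAt (fun p => ((q' p).2 : E)) (0, 0, 0) :=
    continuous_subtype_val.continuousAt.comp cq'.snd
  have cm : ContinuousAt m (0, 0, 0) :=
    L.continuousAt_mul_comp ch' ch (by simp [hq0']) (by simp [hq0])
  -- The product h′h lies in 𝔥 only eventually; its linear 𝔥-component is defined everywhere, is
  -- continuous, and agrees with it there.
  have cmh : ContinuousAt (fun p => (L.decomp.symm (m p)).2) (0, 0, 0) :=
    (L.decomp.symm.continuous.continuousAt.comp cm).snd
  have ev {Y : Type _} [TopologicalSpace Y] {f : E × E × L.V → Y} {y : Y} {s : Y → Prop}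
      (hs : ∀ᶠ y in 𝓝 y, s y) (hf : ContinuousAt f (0, 0, 0)) (hy : f (0, 0, 0) = y) :
      ∀ᶠ p in 𝓝 (0, 0, 0), s (f p) := (hy ▸ hf.tendsto).eventually hs
  filter_upwards [ev L.G.mul_assoc (c1.prodMk (c2.prodMk c3)) (by simp [hsec0]),
    ev L.eventually_secMul_factor ck hk0, ev L.eventually_secMul_factor ck' hk0',
    ev L.G.mul_assoc (c1.prodMk (csq.prodMk ch)) (by simp [hq0, hsec0]),
    ev L.G.mul_assoc (csq'.prodMk (ch'.prodMk ch)) (by simp [hq0, hq0', hsec0]),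
    ev L.mul_mem (cq'.snd.prodMk cq.snd) (by simp [hq0, hq0']),
    ev L.eventually_factor_secMul (cq'.fst.prodMk cmh) (by simp [hq0', hmm0])]
    with p h1 h2 h3 h4 h5 h6 h7
  change L.G.mul (L.sec (q p).1) (q p).2 = k p at h2
  change L.G.mul (L.sec (q' p).1) (q' p).2 = k' p at h3
  change L.G.mul (k' p) (q p).2 = _ at h4
  change _ = L.G.mul (L.sec (q' p).1) (m p) at h5
  change m p ∈ L.𝔥 at h6
  change _ = L.G.mul p.1 (k p) at h1
  change (q' p).1 = (L.factor (L.G.mul (L.G.mul p.1 p.2.1) (L.sec p.2.2))).1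
  rw [L.decomp_symm_of_mem h6] at h7
  change L.factor (L.G.mul (L.sec (q' p).1) (m p)) = _ at h7
  rw [h1, ← h2, ← h4, ← h3, h5, h7]

theorem isLocalAction_act : IsLocalAction L.G L.act :=
  ⟨L.contDiffAt_act.of_infty, L.zero_act, L.act_act⟩

/-- Acting on the base point takes the Q-coordinate of g, and the factorization has derivative
inverse to (ξ, h) ↦ ξ + h. -/
theorem infAct_act_zero (X : E) : infAct L.act 0 X = L.proj X := by
  have h1 : HasFDerivAt (fun g => L.act g 0) (infAct L.act 0) 0 :=
    HasFDerivAt.comp (0 : E) (g := fun p : E × L.V => L.act p.1 p.2) (f := fun g => (g, (0 : L.V)))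
      (L.contDiffAt_act.differentiableAt (by simp)).hasFDerivAt (hasFDerivAt_prodMk_left 0 0)
  have h2 : (fun g => L.act g 0) =ᶠ[𝓝 0] fun g => (L.factor g).1 :=
    L.G.mul_zero.mono fun g hg => by simp only [act, L.sec_zero, hg, projQ_eq]
  have h3 := h1.unique (L.hasFDerivAt_factor.fst.congr_of_eventuallyEq h2)
  rw [h3, ← L.decomp_symm_fst]
  rfl

end EmbeddedLoop

theorem mainTheorem11 {E : Type*} [NormedAddCommGroup E] [NormedSpace ℝ E] [FiniteDimensional ℝ E]
    (L : EmbeddedLoop E) :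
    (ThreeWeb.SymBVanishesAt L.loopMul (0, 0) ↔
      ∀ ξ η ζ : L.V,
        L.proj (L.G.bracket (L.R ξ η) ζ) + L.proj (L.G.bracket (L.R η ζ) ξ)
          + L.proj (L.G.bracket (L.R ζ ξ) η) = 0) ∧
    (ThreeWeb.IsHexagonal L.loopMul →
      ThreeWeb.SymBVanishesAt L.loopMul (0, 0) ∧ ThreeWeb.SymDVanishesAt L.loopMul (0, 0)) ∧
    (ThreeWeb.SymBVanishesAt L.loopMul (0, 0) → ThreeWeb.SymDVanishesAt L.loopMul (0, 0) →
      ∀ ξ η ζ τ : L.V,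
        L.proj (L.G.bracket τ (L.G.bracket (L.R ξ η) ζ)
            - L.G.bracket (L.proj (L.G.bracket τ (L.R ξ η))) ζ)
          + L.proj (L.G.bracket τ (L.G.bracket (L.R η ζ) ξ)
            - L.G.bracket (L.proj (L.G.bracket τ (L.R η ζ))) ξ)
          + L.proj (L.G.bracket τ (L.G.bracket (L.R ζ ξ) η)
            - L.G.bracket (L.proj (L.G.bracket τ (L.R ζ ξ))) η) = 0) := by
  -- `L.loopMul x y` is by definition `L.act (L.sec x) y`, so the results on sections of an action
  -- apply directly.
  have h := L.isLocalAction_act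
  have hs := L.contDiffAt_sec.of_infty
  have hi : infAct L.act 0 ∘L fderiv ℝ L.sec 0 = ContinuousLinearMap.id ℝ L.V := by
    ext v
    simp [L.fderiv_sec_zero, L.infAct_act_zero, L.proj_coe_V]
  have hS (v w : L.V) : infAct L.act 0 (fderiv ℝ (fderiv ℝ L.sec) 0 v w) = 0 := by
    rw [L.fderiv_fderiv_sec_zero, map_smul, L.infAct_act_zero, L.proj_coe_𝔥, smul_zero]
  refine ⟨?_, fun H => ⟨H.self_of_nhds,
    H.symDVanishesAt (h.regularAt_comp_section hs L.sec_zero hi)⟩, fun hB hD ξ η ζ τ => ?_⟩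
  · refine (h.symBVanishesAt_iff hs L.sec_zero hi hS).trans ?_
    rw [← forall_diag_eq_zero_iff_cyclic_sum
      (f := fun ξ η ζ : L.V => L.proj (L.G.bracket (L.R ξ η) ζ))
      (fun a b c => by rw [L.R_symm]) (fun a b b' c => by simp [← L.G.bracketL_apply, L.R_add_right])
      (fun a b c c' => by simp [← L.G.bracketL_apply])]
    refine forall_congr' fun v => ?_
    simp [L.fderiv_fderiv_sec_zero, L.fderiv_sec_zero, L.infAct_act_zero, ← L.G.bracketL_apply]
  · refine (forall_diag_eq_zero_iff_cyclic_sum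
      (f := fun ξ η ζ : L.V => L.proj (L.G.bracket τ (L.G.bracket (L.R ξ η) ζ)
            - L.G.bracket (L.proj (L.G.bracket τ (L.R ξ η))) ζ))
      (fun a b c => by rw [L.R_symm])
      (fun a b b' c => by simp [← L.G.bracketL_apply, L.R_add_right]; abel)
      (fun a b c c' => by simp [← L.G.bracketL_apply]; abel)).1 (fun v => ?_) ξ η ζ
    -- Since S = 2R, this is twice the required identity on the diagonal.
    have key := h.of_symBVanishesAt_of_symDVanishesAt hs L.sec_zero hi hS hB hD v τ
    simp [L.fderiv_fderiv_sec_zero, L.fderiv_sec_zero, L.infAct_act_zero,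
      ← L.G.bracketL_apply, ← smul_sub] at key ⊢
    exact key
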